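/- **Setting.** Let $m,n\ge 0$ be integers, $f:\{0,1\}^n\to\mathbb R$, $H:\{0,1\}^n\to\mathbb R^m$, $M>0$, $S=[-M,M]^m$, and $L(x,\lambda)=f(x)+\lambda^{T}H(x)$. For nonempty $X\subseteq\{0,1\}^n$ let $g_X(\lambda)=\min_{x\in X}L(x,\lambda)$, and let $g=g_{\{0,1\}^n}$ be the Lagrangian dual. The characteristic set is $\chi_g=\bigcup_{\lambda\in\mathbb R^m}\arg\min_{x\in\{0,1\}^n}L(x,\lambda)$. Write points of $\mathbb R^{m+1}$ as $v=(\lambda_v,z_v)$, let $P_x=\{(\lambda,z): z=L(x,\lambda)\}$ and $P_x(\lambda)=L(x,\lambda)$. The *skeleton* of $g_X$ over $S$ is the graph $(\mathcal V_{g_X},\mathcal E_{g_X})$ of vertices and edges of the polyhedron $\Gamma_X=\{(\lambda,z):\lambda\in S,\ z\le g_X(\lambda)\}$. Here $\mathcal V_{g_X}$ consists of the points of $\Gamma_X$ that are not a convex combination, with all weights in $(0,1)$, of any finite subset of $\Gamma_X$ other than themselves. $\mathcal E_{g_X}$ consists of the segments $e(u,v)$, for distinct $u,v\in\mathcal V_{g_X}$,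 such that whenever a point of $e(u,v)$ is such a combination of a finite $W\subseteq\Gamma_X$ one has $W\subseteq e(u,v)$, together with the vertical rays $\{(\lambda_u,z):z\le z_u\}$ for $u\in\mathcal V_{g_X}$ with $\lambda_u\in\{-M,M\}^m$. Put $\mathcal V_g=\mathcal V_{g_{\{0,1\}^n}}$. **Algorithm DualSearch.** An oracle $\mathcal O$ returns, for each $\lambda\in S$, some $\mathcal O(\lambda)\in\arg\min_x L(x,\lambda)$. Call the oracle once at an arbitrary $\lambda_0\in\{-M,M\}^m$, let $x_0=\mathcal O(\lambda_0)$, and set $X=\{x_0\}$, $\mathcal V=\{(\lambda,P_{x_0}(\lambda)):\lambda\in\{-M,M\}^m\}$, $\mathcal E=\mathcal E_{g_X}$. While some vertex of $\mathcal V$ has not been visited, visit any such $v$ and call $x=\mathcal O(\lambda_v)$. If $P_x(\lambda_v)\ge z_v$, then $v$ is *confirmed*. Otherwise add $x$ to $X$, and let $\mathcal V^+=\{u\in P_x\cap e: e\in\mathcal E,\ e\not\subseteq P_x\}$ and $\mathcal V^-=\{u\in\mathcal V: z_u>P_x(\lambda_u)\}$. Add $\mathcal V^+$ to $\mathcal V$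 and remove $\mathcal V^-$. Add to $\mathcal E$ the edges of the convex hull of $\mathcal V^+$, and replace each edge of $\mathcal E$ having an endpoint in $\mathcal V^-$ by its part from the other end (possibly the infinite end of a ray) to its intersection with $P_x$, if the other end is not in $\mathcal V^-$ and this part is not a single point or empty. **Theorem.** For every $m$ there are a constant $C$ and a polynomial $p$, depending only on $m$, such that for all $n,f,H,M$ as above: 1. $\mathcal V_g$ is finite and $|\mathcal V_g|\le C\,|\chi_g|^{m+1}$. Moreover, for every oracle, every starting corner $\lambda_0$ and every order in which the vertices are visited: 2. The initial oracle call yields a first element of $\chi_g$. Every further call, made when visiting a vertex $v$, either confirms $v$, in which case $v\in\mathcal V_g$, $z_v=g(\lambda_v)$, $v$ was not confirmed before and $X$ is unchanged, or adds to $X$ one new element of $\chi_g$ and confirms nothing. 3. The algorithm terminates. The total number of oracle calls is $|\mathcal V_g|+|X|$, where $X$ is the set at termination. If every $x\in\chi_g$ has a facet of its own in the graph of $g$ over $S$, i.e. is the unique minimizer of $L(\cdot,\lambda)$ for some $\lambda\in S$, then the number of oracle calls is exactly $|\mathcal V_g|+|\chi_g|$. 4. In all cases the number of oracle calls is at most $|\mathcal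 V_g|+|\chi_g|$ and at most $p(|\chi_g|)$. -/

import Mathlib

namespace DualSearch

noncomputable section

/-- Assignments `x ∈ {0,1}^n`. -/
abbrev Assign (n : ℕ) := Fin n → Bool

/-- A point `q = (λ_q, z_q)` of `ℝ^{m+1} = ℝ^m × ℝ`. -/
abbrev Pt (m : ℕ) := (Fin m → ℝ) × ℝ

/-- The Lagrangian `L(x,λ) = f(x) + λᵀ H(x)` (with `b = 0`). -/
def lagrangian {n m : ℕ} (f : Assign n → ℝ) (H : Assign n → Fin m → ℝ)
    (x : Assign n) (lam : Fin m → ℝ) : ℝ :=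
  f x + ∑ i, lam i * H x i

/-- `argmin_{x ∈ {0,1}^n} L(x,λ)`, the set of all minimizers. -/
def minimizers {n m : ℕ} (f : Assign n → ℝ) (H : Assign n → Fin m → ℝ)
    (lam : Fin m → ℝ) : Set (Assign n) :=
  {x | ∀ y, lagrangian f H x lam ≤ lagrangian f H y lam}

/-- The characteristic set `χ_g`. -/
def charSet {n m : ℕ} (f : Assign n → ℝ) (H : Assign n → Fin m → ℝ) : Set (Assign n) :=
  ⋃ lam : Fin m → ℝ, minimizers f H lam

/-- The induced dual `g_X(λ) = min_{x ∈ X} L(x,λ)`, for nonempty `X`. -/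
def inducedDual {n m : ℕ} (f : Assign n → ℝ) (H : Assign n → Fin m → ℝ)
    (X : Set (Assign n)) (lam : Fin m → ℝ) : ℝ :=
  sInf ((fun x => lagrangian f H x lam) '' X)

/-- The Lagrangian dual `g = g_{{0,1}^n}`. -/
def dual {n m : ℕ} (f : Assign n → ℝ) (H : Assign n → Fin m → ℝ) (lam : Fin m → ℝ) : ℝ :=
  inducedDual f H Set.univ lam

/-- The search region `S = [-M, M]^m`. -/
def box (m : ℕ) (M : ℝ) : Set (Fin m → ℝ) := {lam | ∀ i, lam i ∈ Set.Icc (-M) M}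

/-- The corners `{-M, M}^m` of the search region. -/
def corners (m : ℕ) (M : ℝ) : Set (Fin m → ℝ) := {lam | ∀ i, lam i = -M ∨ lam i = M}

/-- The hyperplane `P_x = {(λ,z) : z = L(x,λ)}`. -/
def hyperplane {n m : ℕ} (f : Assign n → ℝ) (H : Assign n → Fin m → ℝ)
    (x : Assign n) : Set (Pt m) :=
  {q | q.2 = lagrangian f H x q.1}

/-- `y` is a proper convex combination of the finite set `U`: all weights lie in `(0,1)`. -/
def ProperConvComb {m : ℕ} (y : Pt m) (U : Set (Pt m)) : Prop :=
  ∃ (k : ℕ) (u : Fin k → Pt m) (a : Fin k → ℝ), Set.range u = U ∧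
    (∀ i, a i ∈ Set.Ioo (0 : ℝ) 1) ∧ ∑ i, a i = 1 ∧ y = ∑ i, a i • u i

/-- The points of `Γ` that are proper convex combinations of no subset of `Γ` other than
themselves. -/
def vertexSet {m : ℕ} (Γ : Set (Pt m)) : Set (Pt m) :=
  {v | v ∈ Γ ∧ ∀ U ⊆ Γ, ProperConvComb v U → U = {v}}

/-- The bounded edges of `Γ`, as (nondegenerate) line segments between vertices. -/
def segmentEdges {m : ℕ} (Γ : Set (Pt m)) : Set (Set (Pt m)) :=
  {e | ∃ u ∈ vertexSet Γ, ∃ v ∈ vertexSet Γ, u ≠ v ∧ e = segment ℝ u v ∧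
    ∀ y ∈ e, ∀ W ⊆ Γ, ProperConvComb y W → W ⊆ e}

/-- The vertical edge `e(u, (λ_u, -∞))`. -/
def downRay {m : ℕ} (u : Pt m) : Set (Pt m) := {q | q.1 = u.1 ∧ q.2 ≤ u.2}

/-- `Γ_X(S)`, the part over `S` of the region on or below the graph of `g_X`. -/
def hypograph {n m : ℕ} (f : Assign n → ℝ) (H : Assign n → Fin m → ℝ) (M : ℝ)
    (X : Set (Assign n)) : Set (Pt m) :=
  {q | q.1 ∈ box m M ∧ q.2 ≤ inducedDual f H X q.1}

/-- The vertex set of the skeleton of `g_X` over `S`. -/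
def skeletonVertices {n m : ℕ} (f : Assign n → ℝ) (H : Assign n → Fin m → ℝ) (M : ℝ)
    (X : Set (Assign n)) : Set (Pt m) :=
  vertexSet (hypograph f H M X)

/-- The edge set of the skeleton of `g_X` over `S`: bounded edges, together with the vertical
rays below the vertices that lie over corners of `S`. -/
def skeletonEdges {n m : ℕ} (f : Assign n → ℝ) (H : Assign n → Fin m → ℝ) (M : ℝ)
    (X : Set (Assign n)) : Set (Set (Pt m)) :=
  segmentEdges (hypograph f H M X) ∪
    {e | ∃ u ∈ skeletonVertices f H M X, u.1 ∈ corners m M ∧ e = downRay u}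

/-- The vertex set of the skeleton of the dual `g` over `S`. -/
def dualVertices {n m : ℕ} (f : Assign n → ℝ) (H : Assign n → Fin m → ℝ) (M : ℝ) :
    Set (Pt m) :=
  skeletonVertices f H M Set.univ

/-- The edges of the convex hull of a set of points. -/
def convEdge {m : ℕ} (W : Set (Pt m)) : Set (Set (Pt m)) :=
  segmentEdges (convexHull ℝ W)

/-- `V⁺`: the points where `P` meets an edge not contained in `P`. -/
def newVertices {m : ℕ} (P : Set (Pt m)) (E : Set (Set (Pt m))) : Set (Pt m) :=
  {u | ∃ e ∈ E, ¬ e ⊆ P ∧ u ∈ P ∩ e}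

/-- `V⁻`: the current vertices strictly above `P_x`. -/
def cutVertices {n m : ℕ} (f : Assign n → ℝ) (H : Assign n → Fin m → ℝ) (x : Assign n)
    (V : Set (Pt m)) : Set (Pt m) :=
  {u | u ∈ V ∧ lagrangian f H x u.1 < u.2}

/-- `E⁻`: the current edges with an endpoint in `V⁻`. -/
def cutEdges {m : ℕ} (E : Set (Set (Pt m))) (Vminus : Set (Pt m)) : Set (Set (Pt m)) :=
  {e | e ∈ E ∧ ((∃ u₁ u₂, e = segment ℝ u₁ u₂ ∧ (u₁ ∈ Vminus ∨ u₂ ∈ Vminus)) ∨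
    ∃ u ∈ Vminus, e = downRay u)}

/-- `E⁺`: for each edge `e(u₁,u₂)` in `E⁻` whose end `u₂` is cut off and whose other end `u₁` is
kept, the remaining part `e(u₁,u₃)`, where `u₃ = e(u₁,u₂) ∩ P`. The end `u₁` may be the point at
infinity of a vertical edge. -/
def trimmedEdges {m : ℕ} (P : Set (Pt m)) (E : Set (Set (Pt m))) (Vminus : Set (Pt m)) :
    Set (Set (Pt m)) :=
  {e | ∃ u₁ u₂ u₃, segment ℝ u₁ u₂ ∈ cutEdges E Vminus ∧ u₁ ∉ Vminus ∧ u₂ ∈ Vminus ∧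
      u₃ ∈ segment ℝ u₁ u₂ ∩ P ∧ u₁ ≠ u₃ ∧ e = segment ℝ u₁ u₃} ∪
  {e | ∃ u₂ u₃, downRay u₂ ∈ cutEdges E Vminus ∧ u₂ ∈ Vminus ∧
      u₃ ∈ downRay u₂ ∩ P ∧ e = downRay u₃}

/-- A state of the algorithm: the set `X` of minimizers found, the current graph `(V, E)`, the
vertices already visited at which the oracle gave no improvement, and the number of oracle calls
made so far. -/
structure State (n m : ℕ) where
  X : Set (Assign n)
  V : Set (Pt m)
  E : Set (Set (Pt m))
  confirmed : Set (Pt m)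
  calls : ℕ

/-- `InitSkeleton()`, started at `λ₀`; it makes one oracle call. -/
def initState {n m : ℕ} (f : Assign n → ℝ) (H : Assign n → Fin m → ℝ) (M : ℝ)
    (O : (Fin m → ℝ) → Assign n) (lam₀ : Fin m → ℝ) : State n m where
  X := {O lam₀}
  V := {v | v.1 ∈ corners m M ∧ v.2 = lagrangian f H (O lam₀) v.1}
  E := skeletonEdges f H M {O lam₀}
  confirmed := ∅
  calls := 1

/-- The update of the state when the oracle returns `x` with `P_x(λ_v) < z_v`. -/
def cutState {n m : ℕ} (f : Assign n → ℝ) (H : Assign n → Fin m → ℝ) (s : State n m)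
    (x : Assign n) : State n m where
  X := insert x s.X
  V := (s.V ∪ newVertices (hyperplane f H x) s.E) \ cutVertices f H x s.V
  E := (s.E ∪ convEdge (newVertices (hyperplane f H x) s.E) ∪
      trimmedEdges (hyperplane f H x) s.E (cutVertices f H x s.V)) \
    cutEdges s.E (cutVertices f H x s.V)
  confirmed := s.confirmed
  calls := s.calls + 1

/-- The update of the state when the oracle does not improve on `z_v` at `v`. -/
def confirmState {n m : ℕ} (s : State n m) (v : Pt m) : State n m where
  X := s.X
  V := s.V
  E := s.E
  confirmed := insert v s.confirmed
  calls := s.calls + 1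

/-- `Step f H O s v t`: one iteration of the loop, visiting `v` and leading from `s` to `t`. Any
vertex of `V` not yet visited may be chosen, so that all orders of `V` are covered. -/
inductive Step {n m : ℕ} (f : Assign n → ℝ) (H : Assign n → Fin m → ℝ)
    (O : (Fin m → ℝ) → Assign n) (s : State n m) (v : Pt m) : State n m → Prop
  | cut (hv : v ∈ s.V \ s.confirmed) (hlt : lagrangian f H (O v.1) v.1 < v.2) :
      Step f H O s v (cutState f H s (O v.1))
  | confirm (hv : v ∈ s.V \ s.confirmed) (hge : ¬ lagrangian f H (O v.1) v.1 < v.2) :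
      Step f H O s v (confirmState s v)

/-- `s` is reached by some (partial) execution started at `λ₀`. -/
def Reachable {n m : ℕ} (f : Assign n → ℝ) (H : Assign n → Fin m → ℝ) (M : ℝ)
    (O : (Fin m → ℝ) → Assign n) (lam₀ : Fin m → ℝ) (s : State n m) : Prop :=
  Relation.ReflTransGen (fun s t => ∃ v, Step f H O s v t) (initState f H M O lam₀) s

/-- The loop has ended: no vertex of `V` is left to be visited. -/
def State.Terminal {n m : ℕ} (s : State n m) : Prop := s.V ⊆ s.confirmed

/-- `O` is an oracle on `S`: it returns some minimizer of `L(·,λ)` for every `λ ∈ S`. -/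
def IsOracle {n m : ℕ} (f : Assign n → ℝ) (H : Assign n → Fin m → ℝ) (M : ℝ)
    (O : (Fin m → ℝ) → Assign n) : Prop :=
  ∀ lam ∈ box m M, O lam ∈ minimizers f H lam

/-- Every element of `χ_g` has a facet of its own in the graph of `g` over `S`: it is the only
minimizer of `L(·,λ)` for some `λ ∈ S`. -/
def OwnFacets {n m : ℕ} (f : Assign n → ℝ) (H : Assign n → Fin m → ℝ) (M : ℝ) : Prop :=
  ∀ x ∈ charSet f H, ∃ lam ∈ box m M, minimizers f H lam = {x}

end

end DualSearch

/-! Over the box, the region $\Gamma_X$ below $g_X$ is a polyhedron with $2m+|X|$ constraints.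
Adding $x$ to $X$ intersects it with the halfspace under $P_x$, and the update of $(\mathcal
V,\mathcal E)$ computes exactly the skeleton of this intersection (`cut_vertices`, `cut_edges`).
Hence $(\mathcal V,\mathcal E)$ is always the skeleton of $g_X$, whichever oracle and visiting order
are used; this is the core of `Invariant`.

Counting follows from the invariant. A call at a vertex $v$ of $\Gamma_X$ returns a minimizer $x$ at
$\lambda_v$. If $P_x(\lambda_v)<z_v$, then $x\notin X$, because $v$ satisfies every constraint from
$X$. Otherwise $v$ lies in $\Gamma$, the region below $g$; being extreme in the larger set
$\Gamma_X$, it is extreme in $\Gamma$. So each call after the first adds one to $|X|\le|\chi_g|$ or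
to the number of confirmed vertices, which is at most $|\mathcal V_g|$. This gives termination and
the upper bound.

At termination all vertices of $\Gamma_X$ lie in $\Gamma$. Every point of $\Gamma_X$ is dominated by
a vertex with respect to each linear form $z-\lambda^TH(x)$, so $\Gamma_X=\Gamma$
(`hypoPoly_eq_univ`); the confirmed vertices are then exactly $\mathcal V_g$. An $x$ that is the
only minimizer somewhere on the box must belong to $X$ by then.

For the vertex bound, only constraints from $\chi_g$ matter, and $m+1$ tight constraints determine a
vertex (`extremePoints_poly_finite_and_ncard_le`). -/

open Set Filter Topology

namespace DualSearch

/-! ### Faces, vertices and edges of a polyhedron through its tight constraints. -/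

section Polyhedron

variable {ι E : Type*} [AddCommGroup E] [Module ℝ E]

/-- The polyhedron cut out by the constraints `a i q ≤ b i`, `i ∈ J`. -/
def poly (a : ι → E →ₗ[ℝ] ℝ) (b : ι → ℝ) (J : Set ι) : Set E :=
  {q | ∀ i ∈ J, a i q ≤ b i}

/-- `d` is a direction of the smallest face containing `q`: every constraint that is tight at `q`
vanishes on `d`. -/
def FaceDir (a : ι → E →ₗ[ℝ] ℝ) (b : ι → ℝ) (J : Set ι) (q d : E) : Prop :=
  ∀ i ∈ J, a i q = b i → a i d = 0

variable {a : ι → E →ₗ[ℝ] ℝ} {b : ι → ℝ} {J : Set ι}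

lemma FaceDir.smul {q d : E} (h : FaceDir a b J q d) (c : ℝ) : FaceDir a b J q (c • d) := by
  intro i hi ht
  simp [h i hi ht]

lemma FaceDir.sub {q d d' : E} (h : FaceDir a b J q d) (h' : FaceDir a b J q d') :
    FaceDir a b J q (d - d') := by
  intro i hi ht
  simp [h i hi ht, h' i hi ht]

lemma FaceDir.neg {q d : E} (h : FaceDir a b J q d) : FaceDir a b J q (-d) := by
  intro i hi ht
  simp [h i hi ht]

lemma convex_poly : Convex ℝ (poly a b J) := by
  intro p hp q hq s t hs ht hst i hi
  have h1 := mul_le_mul_of_nonneg_left (hp i hi) hs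
  have h2 := mul_le_mul_of_nonneg_left (hq i hi) ht
  simp only [map_add, map_smul, smul_eq_mul]
  have : s * b i + t * b i = b i := by rw [← add_mul, hst, one_mul]
  linarith

lemma poly_insert (k : ι) : poly a b (insert k J) = poly a b J ∩ {q | a k q ≤ b k} := by
  ext q
  simp only [poly, mem_insert_iff, forall_eq_or_imp, mem_ofPred_eq, mem_inter_iff]
  exact and_comm

/-- Short moves in a direction that increases no tight constraint stay in the polyhedron. -/
lemma eventually_add_smul_mem_poly [Finite ι] {q d : E} (hq : q ∈ poly a b J)
    (hd : ∀ i ∈ J, a i q = b i → a i d ≤ 0) :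
    ∀ᶠ t in 𝓝[>] (0 : ℝ), q + t • d ∈ poly a b J := by
  have key : ∀ i, ∀ᶠ t in 𝓝[>] (0 : ℝ), i ∈ J → a i (q + t • d) ≤ b i := by
    intro i
    by_cases hi : i ∈ J
    · rcases (hq i hi).lt_or_eq with hlt | heq
      · have hc : Tendsto (fun t : ℝ => a i (q + t • d)) (𝓝[>] 0) (𝓝 (a i q)) := by
          have : Tendsto (fun t : ℝ => a i q + t * a i d) (𝓝 0) (𝓝 (a i q + 0 * a i d)) :=
            (by fun_prop : Continuous fun t : ℝ => a i q + t * a i d).tendsto 0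
          simpa using this.mono_left nhdsWithin_le_nhds
        filter_upwards [hc.eventually (gt_mem_nhds hlt)] with t ht _ using ht.le
      · filter_upwards [self_mem_nhdsWithin] with t ht _
        have := mul_nonpos_of_nonneg_of_nonpos (le_of_lt (show (0 : ℝ) < t from ht))
          (hd i hi heq)
        simp only [map_add, map_smul, smul_eq_mul]
        linarith
    · exact Eventually.of_forall fun t h => absurd h hi
  filter_upwards [eventually_all.2 key] with t ht i hi using ht i hi

/-- Moving in a direction that increases some constraint, one stays in the polyhedron until such a
constraint becomes tight. -/
lemma exists_exit [Finite ι] {q d : E} (hq : q ∈ poly a b J) (hd : ∃ i ∈ J, 0 < a i d) :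
    ∃ t : ℝ, 0 ≤ t ∧ q + t • d ∈ poly a b J ∧ ∃ i ∈ J, 0 < a i d ∧ a i (q + t • d) = b i := by
  obtain ⟨i, ⟨hi, hpos⟩, hmin⟩ := Set.exists_min_image {i | i ∈ J ∧ 0 < a i d}
    (fun i => (b i - a i q) / a i d) (Set.toFinite _) hd
  have h0 : 0 ≤ (b i - a i q) / a i d := div_nonneg (sub_nonneg.2 (hq i hi)) hpos.le
  refine ⟨(b i - a i q) / a i d, h0, ?_, i, hi, hpos, ?_⟩
  · intro j hj
    simp only [map_add, map_smul, smul_eq_mul]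
    rcases lt_or_ge 0 (a j d) with hj' | hj'
    · have := (le_div_iff₀ hj').1 (hmin j ⟨hj, hj'⟩)
      linarith
    · have := mul_nonpos_of_nonneg_of_nonpos h0 hj'
      have := hq j hj
      linarith
  · simp only [map_add, map_smul, smul_eq_mul]
    field_simp
    ring

lemma mem_openSegment_sub_add (q d : E) : q ∈ openSegment ℝ (q - d) (q + d) :=
  ⟨1 / 2, 1 / 2, by norm_num, by norm_num, by norm_num, by module⟩

/-- The points `q ± t • d` lie in the polyhedron for small `t`, and `q` is their midpoint, so an
extreme set containing `q` contains them. -/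
lemma FaceDir.of_isExtreme {F : Set E} {q d : E} [Finite ι] (hF : IsExtreme ℝ (poly a b J) F)
    (hq : q ∈ F) (hd : FaceDir a b J q d) : ∃ t : ℝ, 0 < t ∧ q + t • d ∈ F := by
  have hqp := hF.subset hq
  obtain ⟨t, ⟨h1, h2⟩, h3⟩ := (((eventually_add_smul_mem_poly hqp
    fun i hi ht => (hd i hi ht).le).and (eventually_add_smul_mem_poly hqp
    fun i hi ht => (hd.neg i hi ht).le)).and self_mem_nhdsWithin).exists
  refine ⟨t, h3, hF.right_mem_of_mem_openSegment (x := q - t • d) ?_ h1 hq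
    (mem_openSegment_sub_add _ _)⟩
  simpa [sub_eq_add_neg] using h2

/-- The algebraic form of being a vertex. A constraint tight strictly between two points of the
polyhedron is tight at both, so their difference is a face direction. -/
lemma mem_extremePoints_poly_iff [Finite ι] {v : E} :
    v ∈ (poly a b J).extremePoints ℝ ↔ v ∈ poly a b J ∧ ∀ d, FaceDir a b J v d → d = 0 := by
  constructor
  · intro hv
    refine ⟨hv.1, fun d hd => ?_⟩
    obtain ⟨t, ht, h⟩ := FaceDir.of_isExtreme (isExtreme_singleton.2 hv) rfl hd
    simpa [ht.ne'] using h
  · rintro ⟨hv, h⟩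
    refine ⟨hv, fun x hx y hy hxy => ?_⟩
    rw [← sub_eq_zero]
    apply h
    intro i hi ht
    obtain ⟨s, t, hs, ht', hst, rfl⟩ := hxy
    simp only [map_add, map_smul, smul_eq_mul, map_sub] at ht ⊢
    have h1 := hx i hi
    have h2 := hy i hi
    have h3 : s * a i x + t * a i y = s * b i + t * b i := by rw [ht, ← add_mul, hst, one_mul]
    have h4 : a i x = b i := by nlinarith
    have h5 : s * b i + t * b i = b i := by rw [← add_mul, hst, one_mul]
    rw [ht, h4, sub_self]

/-- The points of the polyhedron on the line through `q` with direction `d`. -/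
def lineSection (a : ι → E →ₗ[ℝ] ℝ) (b : ι → ℝ) (J : Set ι) (q d : E) : Set E :=
  {p | p ∈ poly a b J ∧ ∃ c : ℝ, p = q + c • d}

lemma isExtreme_lineSection {q d : E} (hd : FaceDir a b J q d)
    (h : ∀ d', FaceDir a b J q d' → ∃ c : ℝ, d' = c • d) :
    IsExtreme ℝ (poly a b J) (lineSection a b J q d) := by
  refine ⟨fun p hp => hp.1, fun x hx y hy z hz hxy => ⟨hx, ?_⟩⟩
  obtain ⟨hzp, c, hc⟩ := hz
  obtain ⟨c', hc'⟩ := h (x - q) fun i hi ht => by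
    have hzi : a i z = b i := by rw [hc, map_add, map_smul, hd i hi ht, smul_zero, add_zero, ht]
    obtain ⟨s, t, hs, ht', hst, rfl⟩ := hxy
    simp only [map_add, map_smul, smul_eq_mul, map_sub] at hzi ⊢
    have h1 := hx i hi
    have h2 := hy i hi
    have h5 : s * b i + t * b i = b i := by rw [← add_mul, hst, one_mul]
    have h4 : a i x = b i := by nlinarith
    rw [ht, h4, sub_self]
  exact ⟨c', by rw [← hc']; abel⟩

/-- If a one-dimensional face leaves the polyhedron in direction `d`, it ends in a vertex. -/
lemma exists_end [Finite ι] {q d : E} (hq : q ∈ poly a b J)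
    (hd : FaceDir a b J q d) (h : ∀ d', FaceDir a b J q d' → ∃ c : ℝ, d' = c • d)
    (hpos : ∃ i ∈ J, 0 < a i d) :
    ∃ t : ℝ, 0 < t ∧ q + t • d ∈ (poly a b J).extremePoints ℝ ∧
      ∀ c : ℝ, q + c • d ∈ poly a b J → c ≤ t := by
  obtain ⟨t, ht, hp, i, hi, hid, hti⟩ := exists_exit hq hpos
  refine ⟨t, ?_, ?_, ?_⟩
  · refine ht.lt_of_ne fun h0 => ?_
    rw [← h0, zero_smul, add_zero] at hti
    exact hid.ne' (hd i hi hti)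
  -- Tight constraints at `q` stay tight along `d`, so a face direction at the end is a multiple of
  -- `d`; the newly tight constraint `i` is nonzero on `d` and leaves only zero.
  · refine mem_extremePoints_poly_iff.2 ⟨hp, fun d' hd' => ?_⟩
    obtain ⟨c, rfl⟩ := h d' fun j hj htj => hd' j hj (by
      rw [map_add, map_smul, hd j hj htj, smul_zero, add_zero, htj])
    have := hd' i hi hti
    simp only [map_smul, smul_eq_mul, mul_eq_zero, hid.ne', or_false] at this
    rw [this, zero_smul]
  · intro c hc
    have := hc i hi
    rw [← hti] at this
    simp only [map_add, map_smul, smul_eq_mul, add_le_add_iff_left] at this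
    exact le_of_mul_le_mul_right this hid

/-- A bounded one-dimensional face is a segment between two vertices. -/
lemma lineSection_eq_segment [Finite ι] {q d : E} (hq : q ∈ poly a b J) (hd0 : d ≠ 0)
    (hd : FaceDir a b J q d) (h : ∀ d', FaceDir a b J q d' → ∃ c : ℝ, d' = c • d)
    (hpos : ∃ i ∈ J, 0 < a i d) (hneg : ∃ i ∈ J, a i d < 0) :
    ∃ u ∈ (poly a b J).extremePoints ℝ, ∃ v ∈ (poly a b J).extremePoints ℝ, u ≠ v ∧
      lineSection a b J q d = segment ℝ u v := by
  obtain ⟨t, ht, hu, hut⟩ := exists_end hq hd h hpos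
  obtain ⟨s, hs, hv, hvs⟩ := exists_end (d := -d) hq hd.neg
    (fun d' hd' => by
      obtain ⟨c, rfl⟩ := h d' hd'
      exact ⟨-c, by simp⟩) (by simpa using hneg)
  refine ⟨_, hv, _, hu, ?_, ?_⟩
  · intro he
    have : (s + t) • d = 0 := by
      have h1 : q + s • -d - (q + t • d) = 0 := sub_eq_zero.2 he
      have h2 : (s + t) • d = -(q + s • -d - (q + t • d)) := by module
      rw [h2, h1, neg_zero]
    rcases smul_eq_zero.1 this with h' | h'
    · linarith
    · exact hd0 h'
  · ext p
    constructor
    · rintro ⟨hp, c, rfl⟩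
      have h1 := hut c hp
      have h2 := hvs (-c) (by simpa using hp)
      have h3 : 0 < s + t := by linarith
      refine ⟨(t - c) / (s + t), (c + s) / (s + t), div_nonneg (by linarith) h3.le,
        div_nonneg (by linarith) h3.le, by field_simp; ring, ?_⟩
      have h4 : (t - c) / (s + t) + (c + s) / (s + t) = 1 := by field_simp; ring
      have h5 : -((t - c) / (s + t)) * s + (c + s) / (s + t) * t = c := by field_simp; ring
      calc _ = ((t - c) / (s + t) + (c + s) / (s + t)) • q +
            (-((t - c) / (s + t)) * s + (c + s) / (s + t) * t) • d := by module
        _ = _ := by rw [h4, h5, one_smul]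
    · intro hp
      refine ⟨convex_poly.segment_subset hv.1 hu.1 hp, ?_⟩
      obtain ⟨x, y, hx, hy, hxy, rfl⟩ := hp
      refine ⟨-x * s + y * t, ?_⟩
      calc _ = (x + y) • q + (-x * s + y * t) • d := by module
        _ = _ := by rw [hxy, one_smul]

/-- Every vertex at which `h` is not extremal over the whole polyhedron lies on a one-dimensional
face along which `h` is not constant. -/
lemma exists_edge_dir [Finite ι] {v p : E} (hv : v ∈ (poly a b J).extremePoints ℝ)
    (hp : p ∈ poly a b J) (h : E →ₗ[ℝ] ℝ) (hvp : h p ≠ h v) :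
    ∃ d, h d ≠ 0 ∧ ∃ t : ℝ, 0 < t ∧ v + t • d ∈ poly a b J ∧ FaceDir a b J (v + t • d) d ∧
      ∀ d', FaceDir a b J (v + t • d) d' → ∃ c : ℝ, d' = c • d := by
  rw [mem_extremePoints_poly_iff] at hv
  set T : Set ι := {i | i ∈ J ∧ a i v = b i} with hT
  -- Feasible directions at `v` along which `h` varies. One that leaves the fewest tight constraints
  -- strictly will span an edge.
  let cone : Set E := {d | (∀ i ∈ T, a i d ≤ 0) ∧ h d ≠ 0}
  have hcone : (p - v) ∈ cone := by
    refine ⟨fun i hi => ?_, by rw [map_sub]; exact sub_ne_zero.2 hvp⟩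
    rw [map_sub, hi.2]
    exact sub_nonpos.2 (hp i hi.1)
  obtain ⟨d, hd, hmin⟩ : ∃ d ∈ cone, ∀ d' ∈ cone,
      {i | i ∈ T ∧ a i d < 0}.ncard ≤ {i | i ∈ T ∧ a i d' < 0}.ncard := by
    have hne : ((fun d => {i | i ∈ T ∧ a i d < 0}.ncard) '' cone).Nonempty := ⟨_, _, hcone, rfl⟩
    obtain ⟨d, hd, he⟩ := Nat.sInf_mem hne
    exact ⟨d, hd, fun d' hd' => he.le.trans (Nat.sInf_le ⟨d', hd', rfl⟩)⟩
  -- On the directions of the face of the cone through `d`, `h` is injective. Otherwise moving `d`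
  -- within the kernel of `h` makes one more constraint vanish, keeps `h d`, and contradicts
  -- minimality.
  have hline : ∀ d', (∀ i ∈ T, a i d = 0 → a i d' = 0) → h d' = 0 → d' = 0 := by
    intro d' hd' hh
    by_contra hne
    have hex : ∃ d'', (∀ i ∈ T, a i d = 0 → a i d'' = 0) ∧ h d'' = 0 ∧ ∃ i ∈ T, 0 < a i d'' := by
      have : ∃ i ∈ T, a i d' ≠ 0 := by
        by_contra! hall
        exact hne (hv.2 d' fun i hi ht => hall i ⟨hi, ht⟩)
      obtain ⟨i, hi, hi0⟩ := this
      rcases hi0.lt_or_gt with hlt | hgt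
      · exact ⟨-d', fun j hj hj0 => by simp [hd' j hj hj0], by simp [hh], i, hi, by simpa using hlt⟩
      · exact ⟨d', hd', hh, i, hi, hgt⟩
    obtain ⟨d'', hd'', hh'', hpos⟩ := hex
    -- `exists_exit` is used in the homogeneous cone of constraints tight at `v`, starting from the
    -- direction `d`.
    obtain ⟨t, ht, hmem, i, hi, hi0, hti⟩ :=
      exists_exit (b := fun _ => 0) (J := T) (q := d) (d := d'') hd.1 hpos
    refine absurd (hmin (d + t • d'') ⟨hmem, by simpa [hh''] using hd.2⟩) (not_le.2 ?_)
    refine Set.ncard_lt_ncard ?_ (Set.toFinite _)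
    refine (Set.ssubset_iff_of_subset ?_).2 ⟨i, ⟨hi, ?_⟩, fun h' => h'.2.ne hti⟩
    · rintro j ⟨hj, hlt⟩
      refine ⟨hj, (hd.1 j hj).lt_of_ne fun h0 => ?_⟩
      rw [map_add, map_smul, h0, hd'' j hj h0] at hlt
      simp at hlt
    · refine (hd.1 i hi).lt_of_ne fun h0 => ?_
      exact hi0.ne' (hd'' i hi h0)
  obtain ⟨t, hmem, ht⟩ := ((eventually_add_smul_mem_poly hv.1
    (fun i hi hti => hd.1 i ⟨hi, hti⟩)).and self_mem_nhdsWithin).exists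
  replace ht : 0 < t := ht
  have htight : ∀ i ∈ J, a i v = b i → a i d = 0 → a i (v + (t / 2) • d) = b i := by
    intro i _ h1 h2
    rw [map_add, map_smul, h1, h2, smul_zero, add_zero]
  -- Half of the feasible length: a constraint tight at this midpoint is tight at `v` and at `v + t
  -- • d`, hence vanishes on `d`.
  refine ⟨d, hd.2, t / 2, by positivity, ?_, ?_, ?_⟩
  · have := convex_poly.add_smul_mem hv.1 hmem (t := 1 / 2) ⟨by norm_num, by norm_num⟩
    rwa [smul_smul, show 1 / 2 * t = t / 2 by ring] at this
  · intro i hi hti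
    have h1 := hv.1 i hi
    have h2 := hmem i hi
    simp only [map_add, map_smul, smul_eq_mul] at hti h2
    have h3 : a i v = b i := by linarith
    have h4 : t * a i d = 0 := by linarith
    simpa [ht.ne'] using h4
  · intro d' hd'
    refine ⟨h d' / h d, sub_eq_zero.1 (hline _ (fun i hi hi0 => ?_) ?_)⟩
    · rw [map_sub, map_smul, hi0, hd' i hi.1 (htight i hi.1 hi.2 hi0), smul_zero, sub_zero]
    · rw [map_sub, map_smul, smul_eq_mul, div_mul_cancel₀ _ hd.2, sub_self]

/-- If every nonzero direction along which `h` does not decrease leaves the polyhedron, then above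
every point there is a vertex. -/
lemma exists_extremePoint_ge [Finite ι] (h : E →ₗ[ℝ] ℝ)
    (hrec : ∀ d, d ≠ 0 → 0 ≤ h d → ∃ i ∈ J, 0 < a i d) {q : E} (hq : q ∈ poly a b J) :
    ∃ v ∈ (poly a b J).extremePoints ℝ, h q ≤ h v := by
  induction hn : {i | i ∈ J ∧ a i q ≠ b i}.ncard using Nat.strong_induction_on generalizing q with
  | _ n ih =>
  by_cases hv : ∀ d, FaceDir a b J q d → d = 0
  · exact ⟨q, mem_extremePoints_poly_iff.2 ⟨hq, hv⟩, le_rfl⟩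
  push Not at hv
  obtain ⟨d, hd, hd0, hdn⟩ : ∃ d, FaceDir a b J q d ∧ d ≠ 0 ∧ 0 ≤ h d := by
    obtain ⟨d, hd, hd0⟩ := hv
    rcases le_total 0 (h d) with h0 | h0
    · exact ⟨d, hd, hd0, h0⟩
    · exact ⟨-d, hd.neg, neg_ne_zero.2 hd0, by simpa using h0⟩
  obtain ⟨t, ht, hmem, i, hi, hid, hti⟩ := exists_exit hq (hrec d hd0 hdn)
  have hlt : {i | i ∈ J ∧ a i (q + t • d) ≠ b i}.ncard < n := by
    rw [← hn]
    refine Set.ncard_lt_ncard ?_ (Set.toFinite _)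
    refine (Set.ssubset_iff_of_subset ?_).2 ⟨i, ⟨hi, fun h0 => hid.ne' (hd i hi h0)⟩,
      fun h' => h'.2 hti⟩
    rintro j ⟨hj, hne⟩
    refine ⟨hj, fun h0 => hne ?_⟩
    rw [map_add, map_smul, hd j hj h0, smul_zero, add_zero, h0]
  obtain ⟨v, hv, hle⟩ := ih _ hlt hmem rfl
  refine ⟨v, hv, le_trans ?_ hle⟩
  rw [map_add, map_smul, smul_eq_mul]
  have := mul_nonneg ht hdn
  linarith

/-- A vertex is determined by `finrank ℝ E` of the constraints that are tight there. -/
lemma exists_tight_family [FiniteDimensional ℝ E] [Finite ι] {v : E}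
    (hv : v ∈ (poly a b J).extremePoints ℝ) :
    ∃ c : Fin (Module.finrank ℝ E) → ι, (∀ k, c k ∈ J ∧ a (c k) v = b (c k)) ∧
      ∀ d, (∀ k, a (c k) d = 0) → d = 0 := by
  set T : Set ι := {i | i ∈ J ∧ a i v = b i} with hT
  have hker : ∀ d, (∀ i ∈ T, a i d = 0) → d = 0 := fun d hd =>
    (mem_extremePoints_poly_iff.1 hv).2 d fun i hi ht => hd i ⟨hi, ht⟩
  set W : Submodule ℝ (Module.Dual ℝ E) := Submodule.span ℝ (a '' T) with hW
  -- The tight functionals at a vertex have no common zero but `0`, so they span the dual space and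
  -- a basis can be picked among them.
  have hbot : W.dualCoannihilator = ⊥ := by
    rw [eq_bot_iff]
    intro d hd
    rw [Submodule.mem_dualCoannihilator] at hd
    exact hker d fun i hi => hd _ (Submodule.subset_span ⟨i, hi, rfl⟩)
  have hfin : Module.finrank ℝ W = Module.finrank ℝ E := by
    have := Subspace.finrank_add_finrank_dualCoannihilator_eq W
    rwa [hbot, finrank_bot, add_zero] at this
  obtain ⟨g, hg, hspan, -⟩ := Submodule.exists_fun_fin_finrank_span_eq ℝ (a '' T)
  choose c hc using hg
  refine ⟨fun k => c (Fin.cast hfin.symm k), fun k => (hc _).1, fun d hd => hker d ?_⟩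
  have hall : ∀ k, g k d = 0 := fun k => by
    rw [← (hc k).2]
    simpa using hd (Fin.cast hfin k)
  intro i hi
  have hi' : a i ∈ Submodule.span ℝ (range g) := by
    rw [hspan]
    exact Submodule.subset_span ⟨i, hi, rfl⟩
  have hle : Submodule.span ℝ (range g) ≤ (Submodule.span ℝ {d}).dualAnnihilator := by
    rw [Submodule.span_le]
    rintro _ ⟨k, rfl⟩
    rw [SetLike.mem_coe, Submodule.mem_dualAnnihilator]
    intro w hw
    obtain ⟨s, rfl⟩ := Submodule.mem_span_singleton.1 hw
    rw [map_smul, hall, smul_zero]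
  exact (Submodule.mem_dualAnnihilator _).1 (hle hi') d (Submodule.mem_span_singleton_self d)

/-- Sending a vertex to its tight family is injective: two vertices with the same family differ by a
vector on which the whole family vanishes. -/
lemma extremePoints_poly_finite_and_ncard_le [FiniteDimensional ℝ E] [Finite ι] :
    ((poly a b J).extremePoints ℝ).Finite ∧
      ((poly a b J).extremePoints ℝ).ncard ≤ J.ncard ^ Module.finrank ℝ E := by
  classical
  have := Fintype.ofFinite ι
  rcases ((poly a b J).extremePoints ℝ).eq_empty_or_nonempty with he | ⟨v₀, hv₀⟩
  · simp [he]
  have hne : Nonempty (Fin (Module.finrank ℝ E) → ι) := ⟨(exists_tight_family hv₀).choose⟩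
  choose! c hc using fun v (hv : v ∈ (poly a b J).extremePoints ℝ) => exists_tight_family hv
  have hinj : Set.InjOn c ((poly a b J).extremePoints ℝ) := by
    intro v hv w hw hvw
    refine sub_eq_zero.1 ((hc v hv).2 _ fun k => ?_)
    have h1 := ((hc v hv).1 k).2
    have h2 := ((hc w hw).1 k).2
    rw [← hvw] at h2
    rw [map_sub, h1, h2, sub_self]
  have hmaps : Set.MapsTo c ((poly a b J).extremePoints ℝ)
      (Fintype.piFinset fun _ : Fin (Module.finrank ℝ E) => J.toFinset : Finset _) := by
    intro v hv
    simpa using fun k => ((hc v hv).1 k).1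
  refine ⟨Set.Finite.of_injOn hmaps hinj (Finset.finite_toSet _), ?_⟩
  have := Set.ncard_le_ncard_of_injOn c hmaps hinj (Finset.finite_toSet _)
  rw [Set.ncard_coe_finset, Fintype.card_piFinset] at this
  simpa [Set.ncard_eq_toFinset_card'] using this

end Polyhedron
-- Proper convex combinations and extreme sets.
section Faces

variable {m : ℕ}

lemma properConvComb_pair {x y z : Pt m} (h : z ∈ openSegment ℝ x y) :
    ProperConvComb z {x, y} := by
  obtain ⟨s, t, hs, ht, hst, rfl⟩ := h
  refine ⟨2, ![x, y], ![s, t], by simp [Set.pair_comm], ?_, by simpa using hst, by simp⟩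
  intro i
  fin_cases i
  · exact ⟨hs, by simp; linarith⟩
  · exact ⟨ht, by simp; linarith⟩

/-- All terms but the `i`-th are merged into one point, with weights divided by `1 - a i`; this is
positive since weights are below one. -/
lemma exists_openSegment_of_sum {Γ : Set (Pt m)} (hΓ : Convex ℝ Γ) {k : ℕ} {u : Fin k → Pt m}
    {a : Fin k → ℝ} (hu : ∀ i, u i ∈ Γ) (ha : ∀ i, a i ∈ Ioo (0 : ℝ) 1) (hsum : ∑ i, a i = 1)
    (i : Fin k) : ∃ w ∈ Γ, ∑ j, a j • u j ∈ openSegment ℝ (u i) w := by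
  have h1 : ∑ j ∈ Finset.univ.erase i, a j = 1 - a i := by
    rw [← hsum, ← Finset.add_sum_erase _ _ (Finset.mem_univ i)]
    ring
  have hpos : 0 < 1 - a i := by linarith [(ha i).2]
  refine ⟨∑ j ∈ Finset.univ.erase i, (a j / (1 - a i)) • u j, ?_, a i, 1 - a i, (ha i).1, hpos,
    by ring, ?_⟩
  · refine hΓ.sum_mem (fun j _ => div_nonneg (ha j).1.le hpos.le) ?_ fun j _ => hu j
    rw [← Finset.sum_div, h1, div_self hpos.ne']
  · rw [Finset.smul_sum, ← Finset.add_sum_erase _ _ (Finset.mem_univ i)]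
    congr 1
    refine Finset.sum_congr rfl fun j _ => ?_
    rw [smul_smul, mul_div_cancel₀ _ hpos.ne']

/-- Translates the edge condition with finite combinations into Mathlib's two-point notion of
extreme set. -/
lemma forall_properConvComb_iff_isExtreme {Γ e : Set (Pt m)} (hΓ : Convex ℝ Γ) (he : e ⊆ Γ) :
    (∀ y ∈ e, ∀ W ⊆ Γ, ProperConvComb y W → W ⊆ e) ↔ IsExtreme ℝ Γ e := by
  constructor
  · intro h
    refine ⟨he, fun x hx y hy z hz hxy => ?_⟩
    exact h z hz _ (Set.insert_subset hx (Set.singleton_subset_iff.2 hy))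
      (properConvComb_pair hxy) (Set.mem_insert _ _)
  · rintro h y hy _ hW ⟨k, u, a, rfl, ha, hsum, rfl⟩ _ ⟨i, rfl⟩
    obtain ⟨w, hw, hmem⟩ := exists_openSegment_of_sum hΓ (fun j => hW ⟨j, rfl⟩) ha hsum i
    exact h.left_mem_of_mem_openSegment (hW ⟨i, rfl⟩) hw hy hmem

lemma vertexSet_eq_extremePoints {Γ : Set (Pt m)} (hΓ : Convex ℝ Γ) :
    vertexSet Γ = Γ.extremePoints ℝ := by
  ext v
  rw [← isExtreme_singleton]
  constructor
  · rintro ⟨hv, h⟩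
    rw [← forall_properConvComb_iff_isExtreme hΓ (Set.singleton_subset_iff.2 hv)]
    rintro _ rfl W hW hc
    exact (h W hW hc).subset
  · intro h
    refine ⟨h.subset rfl, fun U hU hc => ?_⟩
    have hsub := (forall_properConvComb_iff_isExtreme hΓ h.subset).2 h v rfl U hU hc
    refine hsub.antisymm (Set.singleton_subset_iff.2 ?_)
    obtain ⟨k, u, a, rfl, ha, hsum, -⟩ := hc
    have hk : Nonempty (Fin k) := by
      by_contra hk
      rw [not_nonempty_iff] at hk
      simp at hsum
    have hmem : u hk.some ∈ range u := ⟨_, rfl⟩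
    have := hsub hmem
    rwa [← (show u hk.some = v from this)]

lemma mem_segmentEdges_iff {Γ e : Set (Pt m)} (hΓ : Convex ℝ Γ) :
    e ∈ segmentEdges Γ ↔ ∃ u ∈ Γ.extremePoints ℝ, ∃ v ∈ Γ.extremePoints ℝ, u ≠ v ∧
      e = segment ℝ u v ∧ IsExtreme ℝ Γ e := by
  simp only [segmentEdges, vertexSet_eq_extremePoints hΓ]
  constructor
  · rintro ⟨u, hu, v, hv, hne, rfl, h⟩
    exact ⟨u, hu, v, hv, hne, rfl, (forall_properConvComb_iff_isExtreme hΓ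
      (hΓ.segment_subset hu.1 hv.1)).1 h⟩
  · rintro ⟨u, hu, v, hv, hne, rfl, h⟩
    exact ⟨u, hu, v, hv, hne, rfl, (forall_properConvComb_iff_isExtreme hΓ h.subset).2 h⟩

end Faces

/-! ### Extreme sets and segments cut by a halfspace. -/

section Halfspace

variable {E : Type*} [AddCommGroup E] [Module ℝ E] {A e : Set E}
  (h : E →ₗ[ℝ] ℝ) {β : ℝ}

lemma IsExtreme.inter_halfspace (he : IsExtreme ℝ A e) :
    IsExtreme ℝ (A ∩ {q | h q ≤ β}) (e ∩ {q | h q ≤ β}) :=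
  ⟨fun _ hy => ⟨he.subset hy.1, hy.2⟩, fun _ hx _ hy _ hz hxy =>
    ⟨he.left_mem_of_mem_openSegment hx.1 hy.1 hz.1 hxy, hx.2⟩⟩

lemma isExtreme_inter_hyperplane : IsExtreme ℝ (A ∩ {q | h q ≤ β}) (A ∩ {q | h q = β}) := by
  refine ⟨fun y hy => ⟨hy.1, le_of_eq hy.2⟩, fun x hx y hy z hz hxy => ⟨hx.1, ?_⟩⟩
  obtain ⟨s, t, hs, ht, hst, rfl⟩ := hxy
  have h1 : h x ≤ β := hx.2
  have h2 : h y ≤ β := hy.2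
  have h3 : s * h x + t * h y = β := by simpa using hz.2
  have h4 : s * β + t * β = β := by rw [← add_mul, hst, one_mul]
  change h x = β
  nlinarith

lemma segment_inter_halfspace {u v w : E} (hv : h v ≤ β) (hu : β < h u)
    (hw : w ∈ segment ℝ v u) (hwβ : h w = β) :
    segment ℝ v u ∩ {q | h q ≤ β} = segment ℝ v w := by
  rw [segment_eq_image'] at hw
  obtain ⟨r, ⟨hr0, hr1⟩, rfl⟩ := hw
  have hlt : 0 < h u - h v := by linarith
  simp only [map_add, map_smul, map_sub, smul_eq_mul] at hwβ
  apply subset_antisymm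
  · rintro _ ⟨hy, hyβ⟩
    rw [segment_eq_image'] at hy
    obtain ⟨s, ⟨hs0, hs1⟩, rfl⟩ := hy
    simp only [mem_ofPred_eq, map_add, map_smul, map_sub, smul_eq_mul] at hyβ
    have hsr : s ≤ r := le_of_mul_le_mul_right (by linarith) hlt
    rcases hr0.eq_or_lt with h0 | h0
    · have : s = 0 := by linarith
      simp [← h0, this]
    · rw [segment_eq_image']
      refine ⟨s / r, ⟨by positivity, (div_le_one h0).2 hsr⟩, ?_⟩
      simp only [add_sub_cancel_left, smul_smul, div_mul_cancel₀ _ h0.ne']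
  · rw [segment_eq_image' ℝ v (v + r • (u - v))]
    rintro _ ⟨s, ⟨hs0, hs1⟩, rfl⟩
    simp only [add_sub_cancel_left, smul_smul]
    refine ⟨?_, ?_⟩
    · rw [segment_eq_image']
      exact ⟨s * r, ⟨by positivity, by nlinarith⟩, rfl⟩
    · simp only [mem_ofPred_eq, map_add, map_smul, map_sub, smul_eq_mul]
      have : s * (r * (h u - h v)) ≤ 1 * (r * (h u - h v)) :=
        mul_le_mul_of_nonneg_right hs1 (by positivity)
      linarith

lemma exists_mem_segment_eq {u v : E} (hv : h v ≤ β) (hu : β < h u) :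
    ∃ w ∈ segment ℝ v u, h w = β := by
  have hlt : 0 < h u - h v := by linarith
  refine ⟨v + ((β - h v) / (h u - h v)) • (u - v), ?_, ?_⟩
  · rw [segment_eq_image']
    exact ⟨_, ⟨div_nonneg (by linarith) hlt.le, (div_le_one hlt).2 (by linarith)⟩, rfl⟩
  · simp only [map_add, map_smul, map_sub, smul_eq_mul, div_mul_cancel₀ _ hlt.ne']
    ring

lemma eq_zero_of_mem_extremePoints {v d : E} (hv : v ∈ A.extremePoints ℝ) {s t : ℝ} (hs : 0 < s)
    (ht : 0 < t) (h1 : v - s • d ∈ A) (h2 : v + t • d ∈ A) : d = 0 := by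
  have := hv.2 h1 h2 ⟨t / (s + t), s / (s + t), by positivity, by positivity,
    by field_simp; ring, by
      have h3 : t / (s + t) + s / (s + t) = 1 := by field_simp; ring
      have h4 : -(t / (s + t)) * s + s / (s + t) * t = 0 := by field_simp; ring
      calc _ = (t / (s + t) + s / (s + t)) • v +
            (-(t / (s + t)) * s + s / (s + t) * t) • d := by module
        _ = v := by rw [h3, h4, one_smul, zero_smul, add_zero]⟩
  simpa [hs.ne'] using this

end Halfspace

/-! ### The region below `g_X` as a polyhedron, and its skeleton. -/

section Dual

variable {n m : ℕ}

/-- The constraints describing `Γ_X(S)`: upper and lower bounds on the `λ i`, and the Lagrangians. -/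
abbrev Con (n m : ℕ) := (Fin m ⊕ Fin m) ⊕ Assign n

/-- The linear part `z - λᵀ H(x)` of the constraint `z ≤ L(x,λ)`. -/
noncomputable def height (H : Assign n → Fin m → ℝ) (x : Assign n) : Pt m →ₗ[ℝ] ℝ :=
  LinearMap.snd ℝ _ _ - ∑ i, H x i • (LinearMap.proj i ∘ₗ LinearMap.fst ℝ (Fin m → ℝ) ℝ)

/-- The left hand sides of the constraints. -/
noncomputable def conLin (H : Assign n → Fin m → ℝ) : Con n m → Pt m →ₗ[ℝ] ℝ
  | .inl (.inl i) => LinearMap.proj i ∘ₗ LinearMap.fst ℝ (Fin m → ℝ) ℝ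
  | .inl (.inr i) => -(LinearMap.proj i ∘ₗ LinearMap.fst ℝ (Fin m → ℝ) ℝ)
  | .inr x => height H x

/-- The right hand sides of the constraints. -/
def conBound (f : Assign n → ℝ) (M : ℝ) : Con n m → ℝ
  | .inl _ => M
  | .inr x => f x

/-- The constraints that define `Γ_X(S)`. -/
def conSet (m : ℕ) (X : Set (Assign n)) : Set (Con n m) := {c | ∀ x, c = .inr x → x ∈ X}

/-- `Γ_X(S)` as a polyhedron. -/
noncomputable abbrev hypoPoly (f : Assign n → ℝ) (H : Assign n → Fin m → ℝ) (M : ℝ)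
    (X : Set (Assign n)) : Set (Pt m) :=
  poly (conLin H) (conBound f M) (conSet m X)

variable {f : Assign n → ℝ} {H : Assign n → Fin m → ℝ} {M : ℝ} {X : Set (Assign n)}

@[simp] lemma height_apply (x : Assign n) (q : Pt m) :
    height H x q = q.2 - ∑ i, q.1 i * H x i := by
  simp [height, mul_comm]

lemma lt_height_iff {x : Assign n} {q : Pt m} :
    f x < height H x q ↔ lagrangian f H x q.1 < q.2 := by
  rw [height_apply, lagrangian, lt_sub_iff_add_lt]

lemma height_le_iff {x : Assign n} {q : Pt m} :
    height H x q ≤ f x ↔ q.2 ≤ lagrangian f H x q.1 := by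
  rw [height_apply, lagrangian, sub_le_iff_le_add]

lemma height_eq_iff {x : Assign n} {q : Pt m} :
    height H x q = f x ↔ q.2 = lagrangian f H x q.1 := by
  rw [height_apply, lagrangian, sub_eq_iff_eq_add]

lemma hyperplane_eq (x : Assign n) : hyperplane f H x = {q | height H x q = f x} := by
  ext q
  exact height_eq_iff.symm

@[simp] lemma inl_mem_conSet (i : Fin m ⊕ Fin m) : (.inl i : Con n m) ∈ conSet m X := by
  simp [conSet]

@[simp] lemma inr_mem_conSet (x : Assign n) : (.inr x : Con n m) ∈ conSet m X ↔ x ∈ X := by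
  simp [conSet]

lemma conSet_insert (x : Assign n) :
    conSet m (insert x X) = insert (.inr x) (conSet m X) := by
  ext (c | c) <;> simp

lemma ncard_conSet : (conSet m X).ncard = 2 * m + X.ncard := by
  have h : conSet m X = range Sum.inl ∪ Sum.inr '' X := by
    ext (c | c) <;> simp
  have hd : Disjoint (range (Sum.inl : _ → Con n m)) (Sum.inr '' X) := by
    rw [Set.disjoint_left]
    rintro _ ⟨i, rfl⟩ ⟨x, -, hx⟩
    exact absurd hx (by simp)
  rw [h, Set.ncard_union_eq hd (Set.toFinite _) (Set.toFinite _),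
    Set.ncard_image_of_injective _ Sum.inr_injective, ← Set.image_univ,
    Set.ncard_image_of_injective _ Sum.inl_injective, Set.ncard_univ, Nat.card_eq_fintype_card,
    Fintype.card_sum, Fintype.card_fin, two_mul]

lemma mem_hypoPoly_iff {q : Pt m} :
    q ∈ hypoPoly f H M X ↔ q.1 ∈ box m M ∧ ∀ x ∈ X, q.2 ≤ lagrangian f H x q.1 := by
  constructor
  · intro h
    refine ⟨fun i => ⟨?_, h (.inl (.inl i)) (by simp)⟩, fun x hx =>
      height_le_iff.1 (h (.inr x) (by simpa using hx))⟩
    have : -q.1 i ≤ M := h (.inl (.inr i)) (by simp)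
    linarith
  · rintro ⟨h1, h2⟩ ((i | i) | x) hc
    · exact (h1 i).2
    · have := (h1 i).1
      change -q.1 i ≤ M
      linarith
    · exact height_le_iff.2 (h2 x (by simpa using hc))

lemma faceDir_iff {q d : Pt m} : FaceDir (conLin H) (conBound f M) (conSet m X) q d ↔
    (∀ i, q.1 i = M ∨ q.1 i = -M → d.1 i = 0) ∧
      ∀ x ∈ X, q.2 = lagrangian f H x q.1 → height H x d = 0 := by
  constructor
  · intro h
    refine ⟨?_, fun x hx hq => h (.inr x) (by simpa using hx) (height_eq_iff.2 hq)⟩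
    rintro i (hi | hi)
    · exact h (.inl (.inl i)) (by simp) hi
    · have : -d.1 i = 0 := h (.inl (.inr i)) (by simp) (show -q.1 i = M by rw [hi, neg_neg])
      simpa using this
  · rintro ⟨h1, h2⟩ ((i | i) | x) hc ht
    · exact h1 i (.inl ht)
    · have ht' : -q.1 i = M := ht
      change -d.1 i = 0
      rw [h1 i (.inr (by rw [← ht', neg_neg])), neg_zero]
    · exact h2 x (by simpa using hc) (height_eq_iff.1 ht)

lemma hypoPoly_insert (x : Assign n) :
    hypoPoly f H M (insert x X) = hypoPoly f H M X ∩ {q | height H x q ≤ f x} := by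
  rw [hypoPoly, conSet_insert, poly_insert]
  rfl

lemma faceDir_insert_iff {x : Assign n} {q d : Pt m} :
    FaceDir (conLin H) (conBound f M) (conSet m (insert x X)) q d ↔
      (height H x q = f x → height H x d = 0) ∧
        FaceDir (conLin H) (conBound f M) (conSet m X) q d := by
  simp only [faceDir_iff, forall_mem_insert, height_eq_iff]
  tauto

lemma hypograph_eq (hX : X.Nonempty) : hypograph f H M X = hypoPoly f H M X := by
  ext q
  rw [mem_hypoPoly_iff]
  refine and_congr_right fun _ => ?_
  rw [inducedDual, le_csInf_iff (Set.toFinite _).bddBelow (hX.image _)]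
  simp

lemma skeletonVertices_eq (hX : X.Nonempty) :
    skeletonVertices f H M X = (hypoPoly f H M X).extremePoints ℝ := by
  rw [skeletonVertices, hypograph_eq hX, vertexSet_eq_extremePoints convex_poly]

lemma mem_skeletonEdges_iff (hX : X.Nonempty) {e : Set (Pt m)} :
    e ∈ skeletonEdges f H M X ↔
      (∃ u ∈ (hypoPoly f H M X).extremePoints ℝ, ∃ v ∈ (hypoPoly f H M X).extremePoints ℝ,
        u ≠ v ∧ e = segment ℝ u v ∧ IsExtreme ℝ (hypoPoly f H M X) e) ∨
      ∃ u ∈ (hypoPoly f H M X).extremePoints ℝ, u.1 ∈ corners m M ∧ e = downRay u := by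
  rw [skeletonEdges, hypograph_eq hX, skeletonVertices_eq hX, mem_union,
    mem_segmentEdges_iff convex_poly]
  rfl

lemma corners_subset_box (hM : 0 < M) : corners m M ⊆ box m M := by
  intro q hq i
  rcases hq i with h | h <;> rw [h] <;> constructor <;> linarith

/-- Without a tight Lagrangian the vertical direction would be a face direction. -/
lemma exists_eq_lagrangian_of_mem_extremePoints {v : Pt m}
    (hv : v ∈ (hypoPoly f H M X).extremePoints ℝ) : ∃ x ∈ X, v.2 = lagrangian f H x v.1 := by
  by_contra! h
  have := (mem_extremePoints_poly_iff.1 hv).2 (0, 1)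
    (faceDir_iff.2 ⟨by simp, fun x hx ht => absurd ht (h x hx)⟩)
  simp at this

/-- A vertex is the topmost point over its first component. -/
lemma snd_le_of_mem_extremePoints {v q : Pt m} (hv : v ∈ (hypoPoly f H M X).extremePoints ℝ)
    (hq : q ∈ hypoPoly f H M X) (h : q.1 = v.1) : q.2 ≤ v.2 := by
  obtain ⟨x, hx, hxv⟩ := exists_eq_lagrangian_of_mem_extremePoints hv
  rw [hxv, ← h]
  exact (mem_hypoPoly_iff.1 hq).2 x hx

lemma eq_of_fst_eq {u v : Pt m} (hu : u ∈ (hypoPoly f H M X).extremePoints ℝ)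
    (hv : v ∈ (hypoPoly f H M X).extremePoints ℝ) (h : u.1 = v.1) : u = v :=
  Prod.ext h (le_antisymm (snd_le_of_mem_extremePoints hv hu.1 h)
    (snd_le_of_mem_extremePoints hu hv.1 h.symm))

/-- The box constraints at a corner kill all horizontal directions, and the tight Lagrangian kills
the vertical one. -/
lemma mem_extremePoints_of_mem_corners {v : Pt m} (hv : v ∈ hypoPoly f H M X)
    (hc : v.1 ∈ corners m M) {x : Assign n} (hx : x ∈ X) (hvx : v.2 = lagrangian f H x v.1) :
    v ∈ (hypoPoly f H M X).extremePoints ℝ := by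
  refine mem_extremePoints_poly_iff.2 ⟨hv, fun d hd => ?_⟩
  obtain ⟨h1, h2⟩ := faceDir_iff.1 hd
  have h3 : d.1 = 0 := funext fun i => h1 i (hc i).symm
  have h4 := h2 x hx hvx
  rw [height_apply, h3] at h4
  exact Prod.ext h3 (by simpa using h4)

/-- Every nonzero direction that increases no constraint points straight down. -/
lemma eq_of_conLin_nonpos (hX : X.Nonempty) {d : Pt m} (hd0 : d ≠ 0)
    (hd : ∀ c ∈ conSet m X, conLin H c d ≤ 0) : ∃ r : ℝ, 0 < r ∧ d = r • (0, -1) := by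
  have h1 : d.1 = 0 := funext fun i => le_antisymm (hd (.inl (.inl i)) (by simp)) (by
    have : -d.1 i ≤ 0 := hd (.inl (.inr i)) (by simp)
    simpa using this)
  obtain ⟨x, hx⟩ := hX
  have h2 : height H x d ≤ 0 := hd (.inr x) (by simpa using hx)
  rw [height_apply, h1] at h2
  have h3 : d.2 ≠ 0 := fun h => hd0 (Prod.ext h1 h)
  have h4 : d.2 < 0 := lt_of_le_of_ne (by simpa using h2) h3
  exact ⟨-d.2, by linarith, Prod.ext (by simp [h1]) (by simp)⟩

lemma downRay_subset {u : Pt m} (hu : u ∈ hypoPoly f H M X) : downRay u ⊆ hypoPoly f H M X := by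
  rintro q ⟨h1, h2⟩
  rw [mem_hypoPoly_iff] at hu ⊢
  rw [h1]
  exact ⟨hu.1, fun x hx => h2.trans (hu.2 x hx)⟩

lemma isExtreme_downRay {u : Pt m} (hu : u ∈ (hypoPoly f H M X).extremePoints ℝ)
    (hc : u.1 ∈ corners m M) : IsExtreme ℝ (hypoPoly f H M X) (downRay u) := by
  refine ⟨downRay_subset hu.1, fun x hx y hy z hz hxy => ?_⟩
  have h1 : x.1 = u.1 := by
    obtain ⟨s, t, hs, ht, hst, rfl⟩ := hxy
    funext i
    have h2 : s * x.1 i + t * y.1 i = u.1 i := by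
      rw [← hz.1]
      simp
    have h3 := (mem_hypoPoly_iff.1 hx).1 i
    have h4 := (mem_hypoPoly_iff.1 hy).1 i
    obtain rfl : t = 1 - s := by linarith
    rcases hc i with h | h <;> rw [h] at h2 ⊢
    · refine le_antisymm ?_ h3.1
      have := mul_le_mul_of_nonneg_left h4.1 ht.le
      nlinarith
    · refine le_antisymm h3.2 ?_
      have := mul_le_mul_of_nonneg_left h4.2 ht.le
      nlinarith
  exact ⟨h1, snd_le_of_mem_extremePoints hu hx h1⟩

lemma isExtreme_of_mem_skeletonEdges (hX : X.Nonempty) {e : Set (Pt m)}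
    (he : e ∈ skeletonEdges f H M X) : IsExtreme ℝ (hypoPoly f H M X) e := by
  rcases (mem_skeletonEdges_iff hX).1 he with ⟨u, -, v, -, -, -, h⟩ | ⟨u, hu, hc, rfl⟩
  · exact h
  · exact isExtreme_downRay hu hc

lemma exists_line_of_mem_skeletonEdges (hX : X.Nonempty) {e : Set (Pt m)}
    (he : e ∈ skeletonEdges f H M X) : ∃ p d : Pt m, ∀ y ∈ e, ∃ c : ℝ, y = p + c • d := by
  rcases (mem_skeletonEdges_iff hX).1 he with ⟨u, -, v, -, -, rfl, -⟩ | ⟨u, hu, hc, rfl⟩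
  · refine ⟨u, v - u, fun y hy => ?_⟩
    rw [segment_eq_image'] at hy
    obtain ⟨c, -, rfl⟩ := hy
    exact ⟨c, rfl⟩
  · exact ⟨u, (0, 1), fun y hy => ⟨y.2 - u.2, Prod.ext (by simp [hy.1]) (by simp)⟩⟩

/-- An edge lies on a line, and an affine function that is not constant on a line takes each value
at most once. -/
lemma subsingleton_inter_hyperplane (hX : X.Nonempty) {e : Set (Pt m)}
    (he : e ∈ skeletonEdges f H M X) {x : Assign n} (hne : ¬ e ⊆ hyperplane f H x)
    {u v : Pt m} (hu : u ∈ hyperplane f H x ∩ e) (hv : v ∈ hyperplane f H x ∩ e) : u = v := by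
  obtain ⟨p, d, hline⟩ := exists_line_of_mem_skeletonEdges hX he
  rw [hyperplane_eq] at hne hu hv
  obtain ⟨y, hy, hyP⟩ := Set.not_subset.1 hne
  obtain ⟨cu, rfl⟩ := hline u hu.2
  obtain ⟨cv, rfl⟩ := hline v hv.2
  obtain ⟨cy, rfl⟩ := hline y hy
  have h1 := hu.1
  have h2 := hv.1
  simp only [mem_ofPred_eq, map_add, map_smul, smul_eq_mul] at h1 h2 hyP
  by_cases hd : height H x d = 0
  · rw [hd] at h1 hyP
    exact absurd (by linarith) hyP
  · have : (cu - cv) * height H x d = 0 := by linarith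
    rw [mul_eq_zero, or_iff_left hd, sub_eq_zero] at this
    rw [this]

/-- The one-dimensional faces are edges of the skeleton. -/
lemma lineSection_mem_skeletonEdges (hX : X.Nonempty) {q d : Pt m}
    (hq : q ∈ hypoPoly f H M X) (hd0 : d ≠ 0)
    (hd : FaceDir (conLin H) (conBound f M) (conSet m X) q d)
    (h : ∀ d', FaceDir (conLin H) (conBound f M) (conSet m X) q d' → ∃ c : ℝ, d' = c • d) :
    lineSection (conLin H) (conBound f M) (conSet m X) q d ∈ skeletonEdges f H M X := by
  rw [mem_skeletonEdges_iff hX]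
  -- If `d` or `-d` increases no constraint, it points straight down and the face is a vertical ray;
  -- otherwise the face is bounded on both sides.
  by_cases hbd : (∃ i ∈ conSet m X, 0 < conLin H i d) ∧ ∃ i ∈ conSet m X, conLin H i d < 0
  · left
    obtain ⟨u, hu, v, hv, hne, heq⟩ := lineSection_eq_segment hq hd0 hd h hbd.1 hbd.2
    exact ⟨u, hu, v, hv, hne, heq, isExtreme_lineSection hd h⟩
  right
  obtain ⟨r, hr, rfl⟩ : ∃ r : ℝ, r ≠ 0 ∧ d = r • ((0, -1) : Pt m) := by
    rw [not_and_or] at hbd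
    push Not at hbd
    rcases hbd with hbd | hbd
    · obtain ⟨r, hr, h⟩ := eq_of_conLin_nonpos hX hd0 hbd
      exact ⟨r, hr.ne', h⟩
    · obtain ⟨r, hr, h⟩ := eq_of_conLin_nonpos hX (neg_ne_zero.2 hd0) (by simpa using hbd)
      exact ⟨-r, by simpa using hr.ne', by rw [neg_smul, ← h, neg_neg]⟩
  obtain ⟨-, hx⟩ := faceDir_iff.1 hd
  have hnt : ∀ x ∈ X, q.2 ≠ lagrangian f H x q.1 := by
    intro x hxX ht
    have := hx x hxX ht
    simp [hr] at this
  -- No Lagrangian is tight at `q`, so a coordinate off the box boundary would give a second,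
  -- horizontal face direction.
  have hcorner : q.1 ∈ corners m M := by
    intro i
    by_contra hi
    have hface : FaceDir (conLin H) (conBound f M) (conSet m X) q (Pi.single i 1, 0) := by
      refine faceDir_iff.2 ⟨fun j hj => ?_, fun x hxX ht => absurd ht (hnt x hxX)⟩
      rcases eq_or_ne j i with rfl | hji
      · exact absurd hj.symm hi
      · simp [hji]
    obtain ⟨c, hc⟩ := h _ hface
    have := congrFun (congrArg Prod.fst hc) i
    simp at this
  obtain ⟨x, hxX, hmin⟩ := Set.exists_min_image X (fun x => lagrangian f H x q.1)
    (Set.toFinite _) hX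
  have hqm := mem_hypoPoly_iff.1 hq
  have hu : (q.1, lagrangian f H x q.1) ∈ hypoPoly f H M X :=
    mem_hypoPoly_iff.2 ⟨hqm.1, fun y hy => hmin y hy⟩
  refine ⟨(q.1, lagrangian f H x q.1), mem_extremePoints_of_mem_corners hu hcorner hxX rfl,
    hcorner, ?_⟩
  ext p
  constructor
  · rintro ⟨hp, c, rfl⟩
    exact ⟨by simp, by simpa using (mem_hypoPoly_iff.1 hp).2 x hxX⟩
  · intro hp
    refine ⟨downRay_subset hu hp, (q.2 - p.2) / r, Prod.ext (by simp [hp.1]) ?_⟩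
    simp [div_mul_cancel₀ _ hr]

end Dual

/-! ### One cut: the updated graph is the skeleton of the smaller polyhedron. -/

section Cut

variable {n m : ℕ} {f : Assign n → ℝ} {H : Assign n → Fin m → ℝ} {M : ℝ} {X : Set (Assign n)}
  {x : Assign n}

lemma mem_hypoPoly_insert_iff {q : Pt m} :
    q ∈ hypoPoly f H M (insert x X) ↔ q ∈ hypoPoly f H M X ∧ height H x q ≤ f x := by
  rw [hypoPoly_insert]
  rfl

lemma mem_extremePoints_insert {v : Pt m} (hv : v ∈ (hypoPoly f H M X).extremePoints ℝ)
    (hx : height H x v ≤ f x) : v ∈ (hypoPoly f H M (insert x X)).extremePoints ℝ :=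
  inter_extremePoints_subset_extremePoints_of_subset
    (fun _ hq => (mem_hypoPoly_insert_iff.1 hq).1) ⟨mem_hypoPoly_insert_iff.2 ⟨hv.1, hx⟩, hv⟩

/-- The intersection point is the only common point of two extreme sets: the trace of the edge below
`P_x` and the facet on `P_x`. -/
lemma newVertices_subset (hX : X.Nonempty) :
    newVertices (hyperplane f H x) (skeletonEdges f H M X) ⊆
      (hypoPoly f H M (insert x X)).extremePoints ℝ := by
  rintro u ⟨e, he, hne, hu⟩
  have huΓ := (isExtreme_of_mem_skeletonEdges hX he).subset hu.2
  have huP : height H x u = f x := by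
    have := hu.1
    rwa [hyperplane_eq] at this
  refine ⟨mem_hypoPoly_insert_iff.2 ⟨huΓ, huP.le⟩, fun y hy w hw huyw => ?_⟩
  refine subsingleton_inter_hyperplane hX he hne ?_ hu
  rw [hyperplane_eq, hypoPoly_insert] at *
  exact ⟨((isExtreme_inter_hyperplane (A := hypoPoly f H M X) (height H x) (β := f x)
      ).left_mem_of_mem_openSegment hy hw ⟨huΓ, huP⟩ huyw).2,
    (isExtreme_of_mem_skeletonEdges hX he).left_mem_of_mem_openSegment hy.1 hw.1 hu.2 huyw⟩

/-- Either `v` is an old vertex already on `P_x`, and some old edge at `v` leaves `P_x`; or `v` is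
no old vertex, and its old face is one-dimensional because only zero survives the extra equation. -/
lemma mem_newVertices (hX : X.Nonempty) {v : Pt m}
    (hv : v ∈ (hypoPoly f H M (insert x X)).extremePoints ℝ) (hvP : height H x v = f x) :
    v ∈ newVertices (hyperplane f H x) (skeletonEdges f H M X) := by
  rw [hyperplane_eq]
  have hvΓ := (mem_hypoPoly_insert_iff.1 hv.1).1
  have key : ∀ q d : Pt m, q ∈ hypoPoly f H M X → height H x d ≠ 0 →
      FaceDir (conLin H) (conBound f M) (conSet m X) q d →
      (∀ d', FaceDir (conLin H) (conBound f M) (conSet m X) q d' → ∃ c : ℝ, d' = c • d) →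
      (∃ c : ℝ, v = q + c • d) →
      v ∈ newVertices {q | height H x q = f x} (skeletonEdges f H M X) := by
    rintro q d hq hd0 hd h ⟨c, hc⟩
    have hd1 : d ≠ 0 := by
      rintro rfl
      simp at hd0
    refine ⟨_, lineSection_mem_skeletonEdges hX hq hd1 hd h, fun hsub => ?_, hvP, hvΓ, c, hc⟩
    have hmem : q ∈ lineSection (conLin H) (conBound f M) (conSet m X) q d := ⟨hq, 0, by simp⟩
    obtain ⟨t, ht, hmem'⟩ := FaceDir.of_isExtreme (isExtreme_lineSection hd h) hmem hd
    have h1 : height H x q = f x := hsub hmem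
    have h2 : height H x (q + t • d) = f x := hsub hmem'
    rw [map_add, map_smul, h1, smul_eq_mul, add_eq_left, mul_eq_zero, or_iff_right ht.ne'] at h2
    exact hd0 h2
  by_cases hvX : v ∈ (hypoPoly f H M X).extremePoints ℝ
  -- The point one unit below `v` shows that `height H x` is not constant on the polyhedron, as
  -- `exists_edge_dir` requires.
  · have hp : (v.1, v.2 - 1) ∈ hypoPoly f H M X := downRay_subset hvX.1 ⟨rfl, by simp⟩
    obtain ⟨d, hd0, t, ht, hmem, hface, hline⟩ := exists_edge_dir hvX hp (height H x) (by simp)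
    exact key _ d hmem hd0 hface hline ⟨-t, by simp⟩
  · have hinj : ∀ d, FaceDir (conLin H) (conBound f M) (conSet m X) v d → height H x d = 0 →
        d = 0 := fun d hd h0 =>
      (mem_extremePoints_poly_iff.1 hv).2 d (faceDir_insert_iff.2 ⟨fun _ => h0, hd⟩)
    obtain ⟨d, hd, hd0⟩ : ∃ d, FaceDir (conLin H) (conBound f M) (conSet m X) v d ∧ d ≠ 0 := by
      by_contra! hall
      exact hvX (mem_extremePoints_poly_iff.2 ⟨hvΓ, hall⟩)
    have hh : height H x d ≠ 0 := fun h0 => hd0 (hinj d hd h0)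
    refine key v d hvΓ hh hd (fun d' hd' => ⟨height H x d' / height H x d, ?_⟩) ⟨0, by simp⟩
    refine sub_eq_zero.1 (hinj _ (hd'.sub (hd.smul _)) ?_)
    rw [map_sub, map_smul, smul_eq_mul, div_mul_cancel₀ _ hh, sub_self]

lemma cut_vertices (hX : X.Nonempty) :
    ((hypoPoly f H M X).extremePoints ℝ ∪
        newVertices (hyperplane f H x) (skeletonEdges f H M X)) \
      cutVertices f H x ((hypoPoly f H M X).extremePoints ℝ) =
      (hypoPoly f H M (insert x X)).extremePoints ℝ := by
  ext v
  constructor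
  · rintro ⟨hv | hv, hcut⟩
    · refine mem_extremePoints_insert hv (not_lt.1 fun h => hcut ⟨hv, lt_height_iff.1 h⟩)
    · exact newVertices_subset hX hv
  · intro hv
    have hvm := mem_hypoPoly_insert_iff.1 hv.1
    refine ⟨?_, fun hcut => hvm.2.not_gt (lt_height_iff.2 hcut.2)⟩
    rcases hvm.2.lt_or_eq with hlt | heq
    · left
      refine mem_extremePoints_poly_iff.2 ⟨hvm.1, fun d hd => ?_⟩
      exact (mem_extremePoints_poly_iff.1 hv).2 d
        (faceDir_insert_iff.2 ⟨fun h => absurd h hlt.ne, hd⟩)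
    · exact .inr (mem_newVertices hX hv heq)

lemma isClosed_hypoPoly : IsClosed (hypoPoly f H M X) := by
  have : hypoPoly f H M X =
      ⋂ i ∈ conSet m X, {q | conLin H i q ≤ conBound f M i} := by
    ext q
    simp [hypoPoly, poly]
  rw [this]
  exact isClosed_biInter fun i _ => isClosed_le
    (LinearMap.continuous_of_finiteDimensional _) continuous_const

lemma isCompact_inter_hyperplane :
    IsCompact (hypoPoly f H M X ∩ {q | height H x q = f x}) := by
  have hbox : IsCompact (box m M) := by
    have : box m M = Set.pi univ fun _ => Icc (-M) M := by
      ext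
      simp only [box, mem_ofPred_eq, mem_univ_pi]
    rw [this]
    exact isCompact_univ_pi fun _ => isCompact_Icc
  have hcont : Continuous fun lam : Fin m → ℝ => (lam, lagrangian f H x lam) := by
    unfold lagrangian
    fun_prop
  refine (hbox.image hcont).of_isClosed_subset (isClosed_hypoPoly.inter (isClosed_eq
    (LinearMap.continuous_of_finiteDimensional _) continuous_const)) ?_
  rintro q ⟨hq, hqP⟩
  exact ⟨q.1, (mem_hypoPoly_iff.1 hq).1, Prod.ext rfl (height_eq_iff.1 hqP).symm⟩

lemma isExtreme_facet : IsExtreme ℝ (hypoPoly f H M (insert x X))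
    (hypoPoly f H M X ∩ {q | height H x q = f x}) := by
  rw [hypoPoly_insert]
  exact isExtreme_inter_hyperplane _

lemma convex_facet : Convex ℝ (hypoPoly f H M X ∩ {q | height H x q = f x}) :=
  convex_poly.inter (convex_hyperplane (height H x).isLinear _)

/-- By Krein–Milman the compact facet is the closed hull of its extreme points, which are new
vertices; the hull of finitely many points is already closed. Thus `convEdge` adds exactly the edges
of the facet. -/
lemma convexHull_newVertices (hX : X.Nonempty) :
    convexHull ℝ (newVertices (hyperplane f H x) (skeletonEdges f H M X)) =
      hypoPoly f H M X ∩ {q | height H x q = f x} := by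
  have hfin : (newVertices (hyperplane f H x) (skeletonEdges f H M X)).Finite :=
    extremePoints_poly_finite_and_ncard_le.1.subset (newVertices_subset hX)
  apply subset_antisymm
  · refine convexHull_min (fun u hu => ⟨(mem_hypoPoly_insert_iff.1
      (newVertices_subset hX hu).1).1, ?_⟩) convex_facet
    obtain ⟨e, -, -, hu⟩ := hu
    rw [← hyperplane_eq]
    exact hu.1
  · rw [← closure_convexHull_extremePoints isCompact_inter_hyperplane convex_facet]
    refine closure_minimal (convexHull_mono fun v hv => ?_) (hfin.isClosed_convexHull ℝ)
    exact mem_newVertices hX (isExtreme_facet.extremePoints_subset_extremePoints hv) hv.1.2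

lemma segment_mem_trimmedEdges {E : Set (Set (Pt m))} {V : Set (Pt m)} {u v : Pt m}
    (he : segment ℝ v u ∈ E) (hu : u ∈ V) (hxu : f x < height H x u)
    (hxv : height H x v < f x) :
    segment ℝ v u ∩ {q | height H x q ≤ f x} ∈
      trimmedEdges (hyperplane f H x) E (cutVertices f H x V) := by
  obtain ⟨w, hw, hwx⟩ := exists_mem_segment_eq (height H x) hxv.le hxu
  have hucut : u ∈ cutVertices f H x V := ⟨hu, lt_height_iff.1 hxu⟩
  refine .inl ⟨v, u, w, ⟨he, .inl ⟨v, u, rfl, .inr hucut⟩⟩,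
    fun h => hxv.not_gt (lt_height_iff.2 h.2), hucut, ⟨hw, height_eq_iff.1 hwx⟩, ?_,
    segment_inter_halfspace _ hxv.le hxu hw hwx⟩
  rintro rfl
  exact hxv.ne hwx

lemma extreme_segment_mem_skeletonEdges (hX : X.Nonempty) {u v : Pt m}
    (hu : u ∈ (hypoPoly f H M X).extremePoints ℝ) (hv : v ∈ (hypoPoly f H M X).extremePoints ℝ)
    (hne : u ≠ v) (he : IsExtreme ℝ (hypoPoly f H M X) (segment ℝ u v)) :
    segment ℝ u v ∈ skeletonEdges f H M X :=
  (mem_skeletonEdges_iff hX).2 (.inl ⟨u, hu, v, hv, hne, rfl, he⟩)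

/-- Edges are stored as plain sets, so rays and segments have to be told apart: a ray is unbounded
below. -/
lemma downRay_ne_segment (u p q : Pt m) : downRay u ≠ segment ℝ p q := by
  intro heq
  have hbdd : BddBelow (Prod.snd '' segment ℝ p q) := by
    refine ⟨min p.2 q.2, ?_⟩
    rintro _ ⟨y, ⟨s, t, hs, ht, hst, rfl⟩, rfl⟩
    have i1 := mul_le_mul_of_nonneg_left (min_le_left p.2 q.2) hs
    have i2 := mul_le_mul_of_nonneg_left (min_le_right p.2 q.2) ht
    have i3 : s * min p.2 q.2 + t * min p.2 q.2 = min p.2 q.2 := by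
      rw [← add_mul, hst, one_mul]
    simp only [Prod.snd_add, Prod.smul_snd, smul_eq_mul]
    linarith
  rw [← heq] at hbdd
  obtain ⟨B, hB⟩ := hbdd
  have h1 := min_le_left u.2 B
  have h2 := min_le_right u.2 B
  have h3 : B ≤ min u.2 B - 1 :=
    hB ⟨(u.1, min u.2 B - 1), ⟨rfl, by simp only; linarith⟩, rfl⟩
  linarith

lemma cutState_edges_subset (hX : X.Nonempty) :
    (skeletonEdges f H M X ∪ convEdge (newVertices (hyperplane f H x) (skeletonEdges f H M X)) ∪
        trimmedEdges (hyperplane f H x) (skeletonEdges f H M X)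
          (cutVertices f H x ((hypoPoly f H M X).extremePoints ℝ))) \
      cutEdges (skeletonEdges f H M X)
        (cutVertices f H x ((hypoPoly f H M X).extremePoints ℝ)) ⊆
      skeletonEdges f H M (insert x X) := by
  set V := (hypoPoly f H M X).extremePoints ℝ with hV
  have hle : ∀ u ∈ V, u ∉ cutVertices f H x V → height H x u ≤ f x :=
    fun u hu h => not_lt.1 fun h' => h ⟨hu, lt_height_iff.1 h'⟩
  rintro e ⟨(he | he) | he, hcut⟩
  · rcases (mem_skeletonEdges_iff hX).1 he with ⟨u, hu, v, hv, hne, rfl, hext⟩ | ⟨u, hu, hc, rfl⟩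
    · have hu' := hle u hu fun h => hcut ⟨he, .inl ⟨u, v, rfl, .inl h⟩⟩
      have hv' := hle v hv fun h => hcut ⟨he, .inl ⟨u, v, rfl, .inr h⟩⟩
      have hue := mem_extremePoints_insert hu hu'
      have hve := mem_extremePoints_insert hv hv'
      exact extreme_segment_mem_skeletonEdges (Set.insert_nonempty _ _) hue hve hne
        (hext.mono (fun _ hq => (mem_hypoPoly_insert_iff.1 hq).1)
          (convex_poly.segment_subset hue.1 hve.1))
    · have hu' := hle u hu fun h => hcut ⟨he, .inr ⟨u, h, rfl⟩⟩
      exact (mem_skeletonEdges_iff (Set.insert_nonempty _ _)).2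
        (.inr ⟨u, mem_extremePoints_insert hu hu', hc, rfl⟩)
  · rw [convEdge, convexHull_newVertices hX, mem_segmentEdges_iff convex_facet] at he
    obtain ⟨u, hu, v, hv, hne, rfl, hext⟩ := he
    exact extreme_segment_mem_skeletonEdges (Set.insert_nonempty _ _)
      (isExtreme_facet.extremePoints_subset_extremePoints hu)
      (isExtreme_facet.extremePoints_subset_extremePoints hv) hne (isExtreme_facet.trans hext)
  · have hfacet : ∀ {e u w}, e ∈ skeletonEdges f H M X → u ∈ e → f x < height H x u →
        w ∈ e → w ∈ hyperplane f H x → w ∈ (hypoPoly f H M (insert x X)).extremePoints ℝ := by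
      intro e u w he hu hux hw hwP
      refine newVertices_subset hX ⟨e, he, fun hsub => ?_, hwP, hw⟩
      have := hsub hu
      rw [hyperplane_eq] at this
      exact hux.ne' this
    rcases he with ⟨u₁, u₂, u₃, he, h1, h2, ⟨h3, h3P⟩, hne, rfl⟩ | ⟨u₂, u₃, he, h2, ⟨h3, h3P⟩, rfl⟩
    · have h2x := lt_height_iff.2 h2.2
      have h3e := hfacet he.1 (right_mem_segment ℝ u₁ u₂) h2x h3 h3P
      have hext := isExtreme_of_mem_skeletonEdges hX he.1
      have h3x : height H x u₃ = f x := height_eq_iff.2 h3P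
      -- The definition of `trimmedEdges` does not say that `u₁` is a vertex. The two distinct
      -- extreme ends of this edge must be among `u₁` and `u₂`, so `u₁` is one of them.
      have h1V : u₁ ∈ V := by
        rcases (mem_skeletonEdges_iff hX).1 he.1 with
          ⟨a, ha, b, hb, hab, heq, -⟩ | ⟨u, hu, hc, heq⟩
        · have h1Γ := hext.subset (left_mem_segment ℝ u₁ u₂)
          have ha' := (mem_extremePoints_iff_forall_segment.1 ha).2 u₁ h1Γ u₂ h2.1.1
            (heq ▸ left_mem_segment ℝ a b)
          have hb' := (mem_extremePoints_iff_forall_segment.1 hb).2 u₁ h1Γ u₂ h2.1.1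
            (heq ▸ right_mem_segment ℝ a b)
          rcases ha' with rfl | ha'
          · exact ha
          · rcases hb' with rfl | hb'
            · exact hb
            · exact absurd (ha'.symm.trans hb') hab
        · exact absurd heq.symm (downRay_ne_segment _ _ _)
      have h1x := hle u₁ h1V h1
      have heq := segment_inter_halfspace (height H x) h1x h2x h3 h3x
      rw [← heq]
      have hext' := IsExtreme.inter_halfspace (height H x) (β := f x) hext
      rw [← hypoPoly_insert, heq] at hext'
      rw [heq]
      exact extreme_segment_mem_skeletonEdges (Set.insert_nonempty _ _)
        (mem_extremePoints_insert h1V h1x) h3e hne hext'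
    · have h2x := lt_height_iff.2 h2.2
      have h3e := hfacet he.1 (u := u₂) ⟨rfl, le_rfl⟩ h2x h3 h3P
      refine (mem_skeletonEdges_iff (Set.insert_nonempty _ _)).2 (.inr ⟨u₃, h3e, ?_, rfl⟩)
      rw [h3.1]
      rcases (mem_skeletonEdges_iff hX).1 he.1 with ⟨a, -, b, -, -, heq, -⟩ | ⟨u, hu, hc, heq⟩
      · exact absurd heq (downRay_ne_segment _ _ _)
      · have : u₂ ∈ downRay u := heq ▸ ⟨rfl, le_rfl⟩
        rwa [this.1]

lemma FaceDir.of_add_sub {ι E : Type*} [AddCommGroup E] [Module ℝ E] {a : ι → E →ₗ[ℝ] ℝ}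
    {b : ι → ℝ} {J : Set ι} {q d : E} (h1 : q - d ∈ poly a b J) (h2 : q + d ∈ poly a b J) :
    FaceDir a b J q d := by
  intro i hi ht
  have h3 := h1 i hi
  have h4 := h2 i hi
  rw [map_sub, ht] at h3
  rw [map_add, ht] at h4
  linarith

/-- An edge of the cut polyhedron that does not lie on the new hyperplane is the part below the
hyperplane of an edge of the old skeleton. -/
lemma exists_edge_of_segment (hX : X.Nonempty) {u v : Pt m}
    (hu : u ∈ (hypoPoly f H M (insert x X)).extremePoints ℝ)
    (hv : v ∈ (hypoPoly f H M (insert x X)).extremePoints ℝ) (hne : u ≠ v)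
    (he : IsExtreme ℝ (hypoPoly f H M (insert x X)) (segment ℝ u v))
    (hP : ¬ (height H x u = f x ∧ height H x v = f x)) :
    ∃ F ∈ skeletonEdges f H M X, segment ℝ u v = F ∩ {q | height H x q ≤ f x} ∧
      ∃ q ∈ F, height H x q < f x := by
  -- The midpoint lies strictly below `P_x`, so the new constraint is not tight there and the face
  -- directions at `q` are the same before and after the cut.
  set q : Pt m := (1 / 2 : ℝ) • (u + v) with hq
  set d : Pt m := (1 / 2 : ℝ) • (v - u) with hd
  have hqu : q - d = u := by simp only [hq, hd]; module
  have hqv : q + d = v := by simp only [hq, hd]; module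
  have hqs : q ∈ segment ℝ u v :=
    openSegment_subset_segment ℝ u v (by
      have := mem_openSegment_sub_add q d
      rwa [hqu, hqv] at this)
  have hqx : height H x q < f x := by
    have h1 := (mem_hypoPoly_insert_iff.1 hu.1).2
    have h2 := (mem_hypoPoly_insert_iff.1 hv.1).2
    simp only [hq, map_smul, map_add, smul_eq_mul]
    rcases h1.lt_or_eq with h | h
    · linarith
    · have := h2.lt_of_ne fun h' => hP ⟨h, h'⟩
      linarith
  have hd0 : d ≠ 0 := by
    intro h
    apply hne
    rw [← hqu, ← hqv, h, sub_zero, add_zero]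
  have hface' : FaceDir (conLin H) (conBound f M) (conSet m (insert x X)) q d :=
    FaceDir.of_add_sub (hqu.symm ▸ hu.1) (hqv.symm ▸ hv.1)
  have hface := (faceDir_insert_iff.1 hface').2
  have hsegline : ∀ y ∈ segment ℝ u v, ∃ c : ℝ, y = q + c • d := by
    rintro _ ⟨s, t, -, -, hst, rfl⟩
    refine ⟨t - s, ?_⟩
    rw [← hqu, ← hqv]
    calc _ = (s + t) • q + (t - s) • d := by module
      _ = _ := by rw [hst, one_smul]
  have hline : ∀ d', FaceDir (conLin H) (conBound f M) (conSet m X) q d' →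
      ∃ c : ℝ, d' = c • d := by
    intro d' hd'
    obtain ⟨t, ht, hmem⟩ := FaceDir.of_isExtreme he hqs
      (faceDir_insert_iff.2 ⟨fun h => absurd h hqx.ne, hd'⟩)
    obtain ⟨c, hc⟩ := hsegline _ hmem
    refine ⟨c / t, ?_⟩
    rw [add_right_inj] at hc
    rw [div_eq_inv_mul, mul_smul, ← hc, smul_smul, inv_mul_cancel₀ ht.ne', one_smul]
  have hqΓ := (mem_hypoPoly_insert_iff.1 (he.subset hqs)).1
  refine ⟨_, lineSection_mem_skeletonEdges hX hqΓ hd0 hface hline, ?_, q, ⟨hqΓ, 0, by simp⟩, hqx⟩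
  apply subset_antisymm
  · intro y hy
    have := mem_hypoPoly_insert_iff.1 (he.subset hy)
    exact ⟨⟨this.1, hsegline y hy⟩, this.2⟩
  · rintro y ⟨⟨hy, c, rfl⟩, hyx⟩
    have hyΓ : q + c • d ∈ hypoPoly f H M (insert x X) := mem_hypoPoly_insert_iff.2 ⟨hy, hyx⟩
    have hqΓ' := he.subset hqs
    -- Beyond `c = 1` the vertex `v` would lie strictly between two points of the cut polyhedron;
    -- likewise for `u` below `c = -1`.
    have hc1 : c ≤ 1 := by
      by_contra! hc
      refine hd0 (eq_zero_of_mem_extremePoints hv one_pos (sub_pos.2 hc) ?_ ?_)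
      · rwa [← hqv, one_smul, add_sub_cancel_right]
      · rwa [← hqv, add_assoc, sub_smul, one_smul, add_sub_cancel]
    have hc2 : -1 ≤ c := by
      by_contra! hc
      refine hd0 (eq_zero_of_mem_extremePoints hu (s := -1 - c) (by linarith) one_pos ?_ ?_)
      · have : u - (-1 - c) • d = q + c • d := by rw [← hqu]; module
        rwa [this]
      · rwa [← hqu, one_smul, sub_add_cancel]
    refine ⟨(1 - c) / 2, (1 + c) / 2, by linarith, by linarith, by ring, ?_⟩
    rw [← hqu, ← hqv]
    module

lemma subset_cutState_edges (hX : X.Nonempty) :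
    skeletonEdges f H M (insert x X) ⊆
    (skeletonEdges f H M X ∪ convEdge (newVertices (hyperplane f H x) (skeletonEdges f H M X)) ∪
        trimmedEdges (hyperplane f H x) (skeletonEdges f H M X)
          (cutVertices f H x ((hypoPoly f H M X).extremePoints ℝ))) \
      cutEdges (skeletonEdges f H M X)
        (cutVertices f H x ((hypoPoly f H M X).extremePoints ℝ)) := by
  intro e he
  have hX' := Set.insert_nonempty x X
  have heΓ := (isExtreme_of_mem_skeletonEdges hX' he).subset
  refine ⟨?_, ?_⟩
  swap
  -- Cut vertices lie strictly above `P_x`, outside the new polyhedron, so no new edge contains one.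
  · have hno : ∀ w ∈ cutVertices f H x ((hypoPoly f H M X).extremePoints ℝ), w ∉ e :=
      fun w hw hwe => (mem_hypoPoly_insert_iff.1 (heΓ hwe)).2.not_gt (lt_height_iff.2 hw.2)
    rintro ⟨-, ⟨u₁, u₂, rfl, h | h⟩ | ⟨u, h, rfl⟩⟩
    · exact hno _ h (left_mem_segment ℝ u₁ u₂)
    · exact hno _ h (right_mem_segment ℝ u₁ u₂)
    · exact hno _ h ⟨rfl, le_rfl⟩
  rcases (mem_skeletonEdges_iff hX').1 he with ⟨u, hu, v, hv, hne, rfl, hext⟩ | ⟨u, hu, hc, rfl⟩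
  · by_cases hP : height H x u = f x ∧ height H x v = f x
    · refine .inl (.inr ?_)
      rw [convEdge, convexHull_newVertices hX, mem_segmentEdges_iff convex_facet]
      have hsub := isExtreme_facet (f := f) (H := H) (M := M) (X := X) (x := x)
      have hu' : u ∈ hypoPoly f H M X ∩ {q | height H x q = f x} :=
        ⟨(mem_hypoPoly_insert_iff.1 hu.1).1, hP.1⟩
      have hv' : v ∈ hypoPoly f H M X ∩ {q | height H x q = f x} :=
        ⟨(mem_hypoPoly_insert_iff.1 hv.1).1, hP.2⟩
      refine ⟨u, ?_, v, ?_, hne, rfl, hext.mono hsub.subset (convex_facet.segment_subset hu' hv')⟩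
      · rw [hsub.extremePoints_eq]
        exact ⟨hu', hu⟩
      · rw [hsub.extremePoints_eq]
        exact ⟨hv', hv⟩
    · obtain ⟨F, hF, heq, q, hq, hqx⟩ := exists_edge_of_segment hX hu hv hne hext hP
      rcases (mem_skeletonEdges_iff hX).1 hF with ⟨a, ha, b, hb, hab, rfl, -⟩ | ⟨w, hw, hc, rfl⟩
      · rw [heq]
        have hconv : f x ≤ height H x a → f x ≤ height H x b → False := by
          intro h1 h2
          obtain ⟨s, t, hs, ht, hst, rfl⟩ := hq
          simp only [map_add, map_smul, smul_eq_mul] at hqx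
          have i1 := mul_le_mul_of_nonneg_left h1 hs
          have i2 := mul_le_mul_of_nonneg_left h2 ht
          have i3 : s * f x + t * f x = f x := by rw [← add_mul, hst, one_mul]
          linarith
        rcases lt_or_ge (f x) (height H x b) with hbx | hbx
        · have hax := not_le.1 fun h => hconv h hbx.le
          exact .inr (segment_mem_trimmedEdges hF hb hbx hax)
        · rcases lt_or_ge (f x) (height H x a) with hax | hax
          · have hbx' := not_le.1 fun h => hconv hax.le h
            rw [segment_symm] at hF ⊢
            exact .inr (segment_mem_trimmedEdges hF ha hax hbx')
          · have hsub : segment ℝ a b ⊆ {q | height H x q ≤ f x} :=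
              (convex_halfSpace_le (height H x).isLinear _).segment_subset hax hbx
            rw [inter_eq_left.2 hsub]
            exact .inl (.inl hF)
      -- A vertical ray cannot contain two vertices, since a vertex is determined by its first
      -- component.
      · exfalso
        have hu' : u ∈ downRay w := (heq ▸ left_mem_segment ℝ u v :).1
        have hv' : v ∈ downRay w := (heq ▸ right_mem_segment ℝ u v :).1
        exact hne (eq_of_fst_eq hu hv (hu'.1.trans hv'.1.symm))
  · have hum := mem_hypoPoly_insert_iff.1 hu.1
    obtain ⟨y, hy, hmin⟩ := Set.exists_min_image X (fun y => lagrangian f H y u.1)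
      (Set.toFinite _) hX
    -- The old vertex over the same corner: the new ray is either the old one or what remains of it
    -- below `P_x`.
    set w : Pt m := (u.1, lagrangian f H y u.1) with hw
    have hwΓ : w ∈ hypoPoly f H M X :=
      mem_hypoPoly_iff.2 ⟨(mem_hypoPoly_iff.1 hum.1).1, fun z hz => hmin z hz⟩
    have hwe := mem_extremePoints_of_mem_corners hwΓ hc hy rfl
    have hwE : downRay w ∈ skeletonEdges f H M X :=
      (mem_skeletonEdges_iff hX).2 (.inr ⟨w, hwe, hc, rfl⟩)
    rcases lt_or_ge (f x) (height H x w) with hwx | hwx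
    · have hcut : w ∈ cutVertices f H x ((hypoPoly f H M X).extremePoints ℝ) :=
        ⟨hwe, lt_height_iff.1 hwx⟩
      refine .inr (.inr ⟨w, u, ⟨hwE, .inr ⟨w, hcut, rfl⟩⟩, hcut, ⟨⟨rfl, ?_⟩, ?_⟩, rfl⟩)
      · exact (mem_hypoPoly_iff.1 hum.1).2 y hy
      · obtain ⟨z, hz, hzu⟩ := exists_eq_lagrangian_of_mem_extremePoints hu
        rcases hz with rfl | hz
        · exact hzu
        · exfalso
          have h1 : w.2 ≤ u.2 := hzu ▸ hmin z hz
          exact (height_le_iff.1 hum.2).not_gt ((lt_height_iff.1 hwx).trans_le h1)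
    · rw [eq_of_fst_eq hu (mem_extremePoints_insert hwe hwx) rfl]
      exact .inl (.inl hwE)

/-- The update of the edges turns the skeleton of `g_X` into that of `g_{X ∪ {x}}`. -/
lemma cut_edges (hX : X.Nonempty) :
    (skeletonEdges f H M X ∪ convEdge (newVertices (hyperplane f H x) (skeletonEdges f H M X)) ∪
        trimmedEdges (hyperplane f H x) (skeletonEdges f H M X)
          (cutVertices f H x ((hypoPoly f H M X).extremePoints ℝ))) \
      cutEdges (skeletonEdges f H M X)
        (cutVertices f H x ((hypoPoly f H M X).extremePoints ℝ)) =
      skeletonEdges f H M (insert x X) :=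
  (cutState_edges_subset hX).antisymm (subset_cutState_edges hX)

end Cut

/-! ### The invariant of the algorithm and the count of oracle calls. -/

section Algorithm

variable {n m : ℕ} {f : Assign n → ℝ} {H : Assign n → Fin m → ℝ} {M : ℝ} {X : Set (Assign n)}

lemma exists_mem_minimizers (lam : Fin m → ℝ) : ∃ x, x ∈ minimizers f H lam :=
  Finite.exists_min fun x => lagrangian f H x lam

lemma minimizers_subset_charSet (lam : Fin m → ℝ) : minimizers f H lam ⊆ charSet f H :=
  Set.subset_iUnion (fun lam => minimizers f H lam) lam

lemma charSet_nonempty : (charSet f H).Nonempty :=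
  (exists_mem_minimizers 0).imp fun _ h => minimizers_subset_charSet 0 h

lemma dual_eq {lam : Fin m → ℝ} {x : Assign n} (hx : x ∈ minimizers f H lam) :
    dual f H lam = lagrangian f H x lam := by
  refine IsLeast.csInf_eq ⟨⟨x, mem_univ _, rfl⟩, ?_⟩
  rintro _ ⟨y, -, rfl⟩
  exact hx y

lemma hypoPoly_univ_subset : hypoPoly f H M univ ⊆ hypoPoly f H M X := fun _ hq =>
  mem_hypoPoly_iff.2 ⟨(mem_hypoPoly_iff.1 hq).1, fun x _ => (mem_hypoPoly_iff.1 hq).2 x trivial⟩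

/-- At each `λ` some element of `χ_g` attains the minimum, so the other constraints are redundant.
This makes the vertex bound depend on `|χ_g|` instead of `2^n`. -/
lemma hypoPoly_charSet : hypoPoly f H M (charSet f H) = hypoPoly f H M univ := by
  refine subset_antisymm (fun q hq => ?_) hypoPoly_univ_subset
  rw [mem_hypoPoly_iff] at hq ⊢
  obtain ⟨x, hx⟩ := exists_mem_minimizers (f := f) (H := H) q.1
  exact ⟨hq.1, fun y _ => (hq.2 x (minimizers_subset_charSet _ hx)).trans (hx y)⟩

lemma dualVertices_eq : dualVertices f H M = (hypoPoly f H M univ).extremePoints ℝ :=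
  skeletonVertices_eq univ_nonempty

lemma dualVertices_finite : (dualVertices f H M).Finite := by
  rw [dualVertices_eq]
  exact extremePoints_poly_finite_and_ncard_le.1

lemma ncard_dualVertices_le : (dualVertices f H M).ncard ≤
    (2 * m + 1) ^ (m + 1) * (charSet f H).ncard ^ (m + 1) := by
  have h1 := (extremePoints_poly_finite_and_ncard_le (a := conLin H) (b := conBound f M)
    (J := conSet m (charSet f H))).2
  have h2 : Module.finrank ℝ (Pt m) = m + 1 := by simp
  rw [ncard_conSet, h2] at h1
  have h3 : 1 ≤ (charSet f H).ncard := charSet_nonempty.ncard_pos (Set.toFinite _)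
  rw [dualVertices_eq, ← hypoPoly_charSet, ← mul_pow]
  refine h1.trans (Nat.pow_le_pow_left ?_ _)
  nlinarith

/-- If all vertices of `Γ_X` lie below the dual, then `Γ_X` is the region below the dual. -/
lemma hypoPoly_eq_univ (hX : X.Nonempty)
    (h : (hypoPoly f H M X).extremePoints ℝ ⊆ hypoPoly f H M univ) :
    hypoPoly f H M X = hypoPoly f H M univ := by
  refine subset_antisymm (fun q hq => ?_) hypoPoly_univ_subset
  refine mem_hypoPoly_iff.2 ⟨(mem_hypoPoly_iff.1 hq).1, fun x _ => height_le_iff.1 ?_⟩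
  -- The only directions that increase no constraint point straight down, where `height H x`
  -- decreases.
  have hrec : ∀ d : Pt m, d ≠ 0 → 0 ≤ height H x d → ∃ i ∈ conSet m X, 0 < conLin H i d := by
    intro d hd0 hd
    by_contra! hc
    obtain ⟨r, hr, rfl⟩ := eq_of_conLin_nonpos hX hd0 hc
    simp at hd
    linarith
  obtain ⟨v, hv, hle⟩ := exists_extremePoint_ge (height H x) hrec hq
  exact hle.trans (height_le_iff.2 ((mem_hypoPoly_iff.1 (h hv)).2 x trivial))

/-- The bound at one minimizer puts `v` below the whole dual, and an extreme point of a larger set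
stays extreme in a smaller one containing it. -/
lemma mem_dualVertices_of_le {v : Pt m} {x : Assign n}
    (hv : v ∈ (hypoPoly f H M X).extremePoints ℝ) (hx : x ∈ minimizers f H v.1)
    (hle : v.2 ≤ lagrangian f H x v.1) :
    v ∈ dualVertices f H M ∧ v.2 = dual f H v.1 := by
  have hmem : v ∈ hypoPoly f H M univ :=
    mem_hypoPoly_iff.2 ⟨(mem_hypoPoly_iff.1 hv.1).1, fun y _ => hle.trans (hx y)⟩
  refine ⟨?_, ?_⟩
  · rw [dualVertices_eq]
    exact inter_extremePoints_subset_extremePoints_of_subset hypoPoly_univ_subset ⟨hmem, hv⟩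
  · rw [dual_eq hx]
    obtain ⟨y, -, hy⟩ := exists_eq_lagrangian_of_mem_extremePoints hv
    exact le_antisymm hle (hy ▸ hx y)

/-- The invariant of the algorithm: `(V, E)` is the skeleton of `g_X`, only vertices of the dual
have been confirmed, and every call has confirmed a vertex or found an element of `χ_g`. -/
structure Invariant (f : Assign n → ℝ) (H : Assign n → Fin m → ℝ) (M : ℝ) (s : State n m) :
    Prop where
  nonempty : s.X.Nonempty
  subset_charSet : s.X ⊆ charSet f H
  vertices : s.V = (hypoPoly f H M s.X).extremePoints ℝ
  edges : s.E = skeletonEdges f H M s.X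
  confirmed_subset : s.confirmed ⊆ dualVertices f H M
  calls_eq : s.calls = s.confirmed.ncard + s.X.ncard

variable {O : (Fin m → ℝ) → Assign n} {lam₀ : Fin m → ℝ} {s t : State n m} {v : Pt m}

lemma invariant_initState (hM : 0 < M) (hO : IsOracle f H M O) (h₀ : lam₀ ∈ corners m M) :
    Invariant f H M (initState f H M O lam₀) where
  nonempty := singleton_nonempty _
  subset_charSet := Set.singleton_subset_iff.2
    (minimizers_subset_charSet _ (hO _ (corners_subset_box hM h₀)))
  vertices := by
    ext v
    constructor
    · rintro ⟨hc, hv⟩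
      refine mem_extremePoints_of_mem_corners (mem_hypoPoly_iff.2 ⟨corners_subset_box hM hc, ?_⟩)
        hc rfl hv
      rintro _ rfl
      exact hv.le
    · intro hv
      obtain ⟨x, rfl, hx⟩ := exists_eq_lagrangian_of_mem_extremePoints hv
      refine ⟨fun i => ?_, hx⟩
      by_contra! hi
      -- This direction moves the free coordinate `i` while staying parallel to the only hyperplane
      -- present.
      have := (mem_extremePoints_poly_iff.1 hv).2 (Pi.single i 1, H (O lam₀) i)
        (faceDir_iff.2 ⟨fun j hj => ?_, ?_⟩)
      · have := congrFun (congrArg Prod.fst this) i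
        simp at this
      · rcases eq_or_ne j i with rfl | hji
        · rcases hj with h | h
          · exact absurd h hi.2
          · exact absurd h hi.1
        · simp [hji]
      · rintro _ rfl -
        simp [Pi.single_apply]
  edges := rfl
  confirmed_subset := Set.empty_subset _
  calls_eq := by simp [initState]

lemma Invariant.fst_mem_box (hs : Invariant f H M s) (hv : v ∈ s.V) : v.1 ∈ box m M := by
  rw [hs.vertices] at hv
  exact (mem_hypoPoly_iff.1 hv.1).1

lemma Invariant.not_mem_of_lt (hs : Invariant f H M s) (hv : v ∈ s.V) {x : Assign n}
    (hlt : lagrangian f H x v.1 < v.2) : x ∉ s.X := by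
  intro hx
  rw [hs.vertices] at hv
  exact ((mem_hypoPoly_iff.1 hv.1).2 x hx).not_gt hlt

lemma Invariant.step (hO : IsOracle f H M O) (hs : Invariant f H M s) (hst : Step f H O s v t) :
    Invariant f H M t := by
  cases hst with
  | cut hv hlt =>
    have hx := hO _ (hs.fst_mem_box hv.1)
    refine ⟨Set.insert_nonempty _ _, Set.insert_subset (minimizers_subset_charSet _ hx)
      hs.subset_charSet, ?_, ?_, hs.confirmed_subset, ?_⟩
    · simp only [cutState, hs.vertices, hs.edges]
      exact cut_vertices hs.nonempty
    · simp only [cutState, hs.vertices, hs.edges]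
      exact cut_edges hs.nonempty
    · simp only [cutState]
      rw [Set.ncard_insert_of_notMem (hs.not_mem_of_lt hv.1 hlt) (Set.toFinite _), hs.calls_eq]
      rfl
  | confirm hv hge =>
    have hx := hO _ (hs.fst_mem_box hv.1)
    refine ⟨hs.nonempty, hs.subset_charSet, hs.vertices, hs.edges, ?_, ?_⟩
    · exact Set.insert_subset (mem_dualVertices_of_le (hs.vertices ▸ hv.1) hx (not_lt.1 hge)).1
        hs.confirmed_subset
    · simp only [confirmState]
      rw [Set.ncard_insert_of_notMem hv.2 (dualVertices_finite.subset hs.confirmed_subset),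
        hs.calls_eq]
      omega

lemma Reachable.invariant (hM : 0 < M) (hO : IsOracle f H M O) (h₀ : lam₀ ∈ corners m M)
    (hs : Reachable f H M O lam₀ s) : Invariant f H M s := by
  induction hs with
  | refl => exact invariant_initState hM hO h₀
  | tail _ hst ih =>
    obtain ⟨v, hv⟩ := hst
    exact ih.step hO hv

lemma Invariant.calls_le (hs : Invariant f H M s) :
    s.calls ≤ (dualVertices f H M).ncard + (charSet f H).ncard := by
  rw [hs.calls_eq]
  exact add_le_add (Set.ncard_le_ncard hs.confirmed_subset dualVertices_finite)
    (Set.ncard_le_ncard hs.subset_charSet (Set.toFinite _))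

lemma Step.calls_eq (hst : Step f H O s v t) : t.calls = s.calls + 1 := by
  cases hst <;> rfl

lemma Invariant.step_cases (hO : IsOracle f H M O) (hs : Invariant f H M s)
    (hst : Step f H O s v t) :
    (v ∈ dualVertices f H M ∧ v.2 = dual f H v.1 ∧ v ∉ s.confirmed ∧
        t.confirmed = insert v s.confirmed ∧ t.X = s.X) ∨
      ∃ x ∈ charSet f H, x ∉ s.X ∧ t.X = insert x s.X ∧ t.confirmed = s.confirmed := by
  cases hst with
  | cut hv hlt =>
    exact .inr ⟨_, minimizers_subset_charSet _ (hO _ (hs.fst_mem_box hv.1)),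
      hs.not_mem_of_lt hv.1 hlt, rfl, rfl⟩
  | confirm hv hge =>
    have h := mem_dualVertices_of_le (hs.vertices ▸ hv.1) (hO _ (hs.fst_mem_box hv.1))
      (not_lt.1 hge)
    exact .inl ⟨h.1, h.2, hv.2, rfl, rfl⟩

lemma exists_step_of_not_terminal (hs : ¬ s.Terminal) : ∃ v t, Step f H O s v t := by
  obtain ⟨v, hv⟩ := Set.not_subset.1 hs
  by_cases hlt : lagrangian f H (O v.1) v.1 < v.2
  · exact ⟨v, _, .cut hv hlt⟩
  · exact ⟨v, _, .confirm hv hlt⟩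

/-- The counter grows by one at each step but is bounded by `Invariant.calls_le`. -/
lemma not_exists_infinite_run (hM : 0 < M) (hO : IsOracle f H M O) (h₀ : lam₀ ∈ corners m M) :
    ¬ ∃ σ : ℕ → State n m, σ 0 = initState f H M O lam₀ ∧
      ∀ k, ∃ v, Step f H O (σ k) v (σ (k + 1)) := by
  rintro ⟨σ, h0, hstep⟩
  have hreach : ∀ k, Reachable f H M O lam₀ (σ k) := by
    intro k
    induction k with
    | zero => rw [h0]; exact .refl
    | succ k ih => exact ih.tail (hstep k)
  have hcalls : ∀ k, k ≤ (σ k).calls := by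
    intro k
    induction k with
    | zero => exact Nat.zero_le _
    | succ k ih =>
      obtain ⟨v, hv⟩ := hstep k
      rw [hv.calls_eq]
      omega
  have h1 := hcalls ((dualVertices f H M).ncard + (charSet f H).ncard + 1)
  have h2 := ((hreach ((dualVertices f H M).ncard + (charSet f H).ncard + 1)).invariant
    hM hO h₀).calls_le
  omega

lemma Invariant.hypoPoly_eq (hs : Invariant f H M s) (ht : s.Terminal) :
    hypoPoly f H M s.X = hypoPoly f H M univ := by
  refine hypoPoly_eq_univ hs.nonempty fun v hv => ?_
  rw [← hs.vertices] at hv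
  have := hs.confirmed_subset (ht hv)
  rw [dualVertices_eq] at this
  exact this.1

lemma Invariant.calls_eq_of_terminal (hs : Invariant f H M s) (ht : s.Terminal) :
    s.calls = (dualVertices f H M).ncard + s.X.ncard := by
  have : s.confirmed = dualVertices f H M := by
    refine hs.confirmed_subset.antisymm (Set.Subset.trans ?_ ht)
    rw [hs.vertices, hs.hypoPoly_eq ht, dualVertices_eq]
  rw [hs.calls_eq, this]

lemma Invariant.eq_charSet_of_terminal (hs : Invariant f H M s) (ht : s.Terminal)
    (hown : OwnFacets f H M) : s.X = charSet f H := by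
  refine hs.subset_charSet.antisymm fun x hx => ?_
  obtain ⟨lam, hlam, hmin⟩ := hown x hx
  -- The best `y` in `X` attains the dual at `lam` because the two regions agree, so it is the
  -- unique minimizer `x`.
  obtain ⟨y, hy, hyle⟩ := Set.exists_min_image s.X (fun y => lagrangian f H y lam)
    (Set.toFinite _) hs.nonempty
  have hmem : (lam, lagrangian f H y lam) ∈ hypoPoly f H M s.X :=
    mem_hypoPoly_iff.2 ⟨hlam, hyle⟩
  rw [hs.hypoPoly_eq ht] at hmem
  have : y ∈ minimizers f H lam := fun z => (mem_hypoPoly_iff.1 hmem).2 z trivial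
  rw [hmin] at this
  rwa [← (show y = x from this)]

end Algorithm

end DualSearch

theorem mainTheorem2 (m : ℕ) :
    ∃ (C : ℕ) (p : Polynomial ℕ), ∀ (n : ℕ) (f : DualSearch.Assign n → ℝ)
      (H : DualSearch.Assign n → Fin m → ℝ) (M : ℝ), 0 < M →
      -- the vertex bound
      (DualSearch.dualVertices f H M).Finite ∧
      (DualSearch.dualVertices f H M).ncard ≤ C * (DualSearch.charSet f H).ncard ^ (m + 1) ∧
      ∀ O : (Fin m → ℝ) → DualSearch.Assign n, DualSearch.IsOracle f H M O →
      ∀ lam₀ ∈ DualSearch.corners m M,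
        -- the initial oracle call finds a first element of the characteristic set
        ((DualSearch.initState f H M O lam₀).calls = 1 ∧
          ∃ x ∈ DualSearch.charSet f H, (DualSearch.initState f H M O lam₀).X = {x}) ∧
        -- every later call confirms one new vertex of the final skeleton, or finds one new
        -- element of the characteristic set
        (∀ s v t, DualSearch.Reachable f H M O lam₀ s → DualSearch.Step f H O s v t →
          t.calls = s.calls + 1 ∧
          ((v ∈ DualSearch.dualVertices f H M ∧ v.2 = DualSearch.dual f H v.1 ∧
              v ∉ s.confirmed ∧ t.confirmed = insert v s.confirmed ∧ t.X = s.X) ∨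
            (∃ x ∈ DualSearch.charSet f H, x ∉ s.X ∧ t.X = insert x s.X ∧
              t.confirmed = s.confirmed))) ∧
        -- every execution runs to its end
        (∀ s, DualSearch.Reachable f H M O lam₀ s → ¬ s.Terminal →
          ∃ v t, DualSearch.Step f H O s v t) ∧
        (¬ ∃ σ : ℕ → DualSearch.State n m, σ 0 = DualSearch.initState f H M O lam₀ ∧
          ∀ k, ∃ v, DualSearch.Step f H O (σ k) v (σ (k + 1))) ∧
        -- the exact number of oracle calls
        (∀ s, DualSearch.Reachable f H M O lam₀ s → s.Terminal →
          s.calls = (DualSearch.dualVertices f H M).ncard + s.X.ncard ∧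
          (DualSearch.OwnFacets f H M →
            s.calls = (DualSearch.dualVertices f H M).ncard +
              (DualSearch.charSet f H).ncard)) ∧
        -- the query complexity
        (∀ s, DualSearch.Reachable f H M O lam₀ s →
          s.calls ≤ (DualSearch.dualVertices f H M).ncard + (DualSearch.charSet f H).ncard ∧
          s.calls ≤ p.eval (DualSearch.charSet f H).ncard) := by
  open DualSearch in
  refine ⟨(2 * m + 1) ^ (m + 1),
    Polynomial.C ((2 * m + 1) ^ (m + 1)) * Polynomial.X ^ (m + 1) + Polynomial.X,
    fun n f H M hM => ⟨dualVertices_finite, ncard_dualVertices_le, fun O hO lam₀ h₀ => ?_⟩⟩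
  open DualSearch in
  exact ⟨⟨rfl, O lam₀, minimizers_subset_charSet _ (hO _ (corners_subset_box hM h₀)), rfl⟩,
    fun s v t hs hst => ⟨hst.calls_eq, (hs.invariant hM hO h₀).step_cases hO hst⟩,
    fun s _ hs => exists_step_of_not_terminal hs,
    not_exists_infinite_run hM hO h₀,
    fun s hs ht => by
      have h := (hs.invariant hM hO h₀).calls_eq_of_terminal ht
      refine ⟨h, fun hown => ?_⟩
      rw [h, (hs.invariant hM hO h₀).eq_charSet_of_terminal ht hown],
    fun s hs => by
      have h := (hs.invariant hM hO h₀).calls_le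
      refine ⟨h, h.trans ?_⟩
      simpa using ncard_dualVertices_le⟩
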